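/- Let $\mathcal A$ be a (possibly nonunital) $C^*$-algebra, $\mathbb V$ a right $\mathcal A$-module (no inner product is assumed), $\mathcal B,\mathcal C$ $W^*$-algebras with von Neumann algebra tensor product $\mathcal B\otimes\mathcal C$, $G$ a group, $\beta$ and $\gamma$ actions of $G$ by $*$-automorphisms on $\mathcal B$ and $\mathcal C$, $\delta_g=\beta_g\otimes\gamma_g$, and $U$ a representation of $G$ on $\mathbb V$ by $\mathcal A$-linear bijections. Let $S_{\mathcal A}(\mathbb V)$ be the space of $\mathcal A$-sesquilinear forms $\mathbb V\times\mathbb V\to\mathcal A$ (conjugate linear in the first argument). A linear map $T:\mathcal D\to S_{\mathcal A}(\mathbb V)$ on a unital $C^*$-algebra $\mathcal D$ is completely positive (CP) if $\sum_{j,k=1}^n T_{d_j^*d_k}(v_j,v_k)\ge 0$ for all $n$, $d_j\in\mathcal D$, $v_j\in\mathbb V$; it is covariant with respect to an action $\alpha$ of $G$ on $\mathcal D$ and $U$ if $T_{\alpha_g(d)}(v,w)=T_d(U(g^{-1})v,U(g^{-1})w)$. For a Hilbert $\mathcal A$-module $\mathbb M$, a linear map $F$ from $\mathcal D$ to the $C^*$-algebra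 $\mathcal L_{\mathcal A}(\mathbb M)$ of adjointable operators is CP if $d\mapsto\langle\,\cdot\,|F(d)\,\cdot\,\rangle\in S_{\mathcal A}(\mathbb M)$ is CP. Let $S:\mathcal B\otimes\mathcal C\to S_{\mathcal A}(\mathbb V)$ be a $(\delta,U)$-covariant CP map with marginals $S^1_b=S_{b\otimes 1}$ and $S^2_c=S_{1\otimes c}$. A covariant dilation of $S^1$ is a quadruple $(\mathbb M,\pi,K,\tilde U)$ of a Hilbert $\mathcal A$-module $\mathbb M$, a unital $*$-homomorphism $\pi:\mathcal B\to\mathcal L_{\mathcal A}(\mathbb M)$, an $\mathcal A$-linear map $K:\mathbb V\to\mathbb M$ and a unitary representation $\tilde U$ of $G$ in $\mathcal L_{\mathcal A}(\mathbb M)$ with $S^1_b(v,w)=\langle Kv|\pi(b)Kw\rangle$, $KU(g)=\tilde U(g)K$ and $\tilde U(g)\pi(b)=\pi(\beta_g(b))\tilde U(g)$. It is minimal if $\mathrm{lin}\{\pi(b)Kv\}$ is norm dense in $\mathbb M$. If $\mathcal A$ is a $W^*$-algebra, it is $W^*$-minimal if $\mathbb M$ is self-dual (every bounded $\mathcal A$-linear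 map $\mathbb M\to\mathcal A$ is of the form $\langle m|\,\cdot\,\rangle$) and $\mathrm{lin}\{\pi(b)Kv\}$ is dense in $\mathbb M$ for the topology $\tau_1$ of the seminorms $m\mapsto\varphi(\langle m|m\rangle)^{1/2}$ or for the topology $\tau_2$ of the seminorms $m\mapsto|\varphi(\langle m'|m\rangle)|$, where $\varphi$ runs over the positive normal functionals on $\mathcal A$ and $m'$ over $\mathbb M$. (a) Suppose that $S^1$ is regular, i.e. that it has a minimal covariant dilation $(\mathbb M,\pi,K,\tilde U)$ with $\mathbb M$ self-dual. Then there is a unique CP map $E:\mathcal C\to\mathcal L_{\mathcal A}(\mathbb M)$ such that $$\tilde U(g)E(c)=E(\gamma_g(c))\tilde U(g),\qquad \pi(b)E(c)=E(c)\pi(b),\qquad S_{b\otimes c}(v,w)=\langle Kv|\pi(b)E(c)Kw\rangle$$ for all $g\in G$, $b\in\mathcal B$, $c\in\mathcal C$, $v,w\in\mathbb V$, and $E$ is unital. (b) Suppose that $\mathcal A$ is a $W^*$-algebra and $(\mathbb L,\pi,K,\tilde U)$ is a $W^*$-minimal covariant dilation of $S^1$. Then there is a unique CP map $E:\mathcal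 C\to\mathcal L_{\mathcal A}(\mathbb L)$ with the same three properties, and $E$ is unital. Moreover, $S^2$ is normal (i.e. $c\mapsto S^2_c(v,v)$ is normal for every $v\in\mathbb V$) if and only if $E$ is normal, where a positive linear map is normal if it preserves suprema of bounded increasing nets of self-adjoint elements. -/

import Mathlib

open scoped RightActions ComplexOrder TensorProduct

noncomputable section

namespace CovKSGNS

/-! ### Right modules, sesquilinear forms, Hilbert modules -/

/-- A complex vector space with a compatible right action `v <• a` of a (possibly nonunital)
complex algebra `A`. No inner product is assumed. -/
class RightModule (A V : Type*) [NonUnitalRing A] [Module ℂ A] [AddCommGroup V] [Module ℂ V]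
    [SMul Aᵐᵒᵖ V] : Prop where
  add_act : ∀ (v w : V) (a : A), (v + w) <• a = v <• a + w <• a
  act_add : ∀ (v : V) (a b : A), v <• (a + b) = v <• a + v <• b
  act_mul : ∀ (v : V) (a b : A), v <• (a * b) = (v <• a) <• b
  smul_act : ∀ (z : ℂ) (v : V) (a : A), (z • v) <• a = z • (v <• a)
  act_smul : ∀ (z : ℂ) (v : V) (a : A), v <• (z • a) = z • (v <• a)

/-- The complex vector space `S_A(V)` of `A`-sesquilinear forms `V × V → A` (conjugate linear in
the first argument, linear in the second, with pointwise operations). -/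
def SesqForm (A V : Type*) [NonUnitalCStarAlgebra A] [AddCommGroup V] [Module ℂ V]
    [SMul Aᵐᵒᵖ V] : Submodule ℂ (V → V → A) where
  carrier := {s |
    (∀ (u v w : V) (z : ℂ), s u (v + z • w) = s u v + z • s u w) ∧
    (∀ (u v w : V) (z : ℂ), s (v + z • w) u = s v u + star z • s w u) ∧
    (∀ (u v : V) (a : A), s u (v <• a) = s u v * a) ∧
    (∀ (u v : V) (a : A), s (u <• a) v = star a * s u v)}
  zero_mem' := by simp
  add_mem' := by
    rintro s t ⟨h1, h2, h3, h4⟩ ⟨k1, k2, k3, k4⟩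
    refine ⟨fun u v w z => ?_, fun u v w z => ?_, fun u v a => ?_, fun u v a => ?_⟩
    · simp only [Pi.add_apply, h1, k1, smul_add]; abel
    · simp only [Pi.add_apply, h2, k2, smul_add]; abel
    · simp only [Pi.add_apply, h3, k3, add_mul]
    · simp only [Pi.add_apply, h4, k4, mul_add]
  smul_mem' := by
    rintro c s ⟨h1, h2, h3, h4⟩
    refine ⟨fun u v w z => ?_, fun u v w z => ?_, fun u v a => ?_, fun u v a => ?_⟩
    · simp only [Pi.smul_apply, h1, smul_add, smul_comm c z]
    · simp only [Pi.smul_apply, h2, smul_add, smul_comm c (star z)]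
    · simp only [Pi.smul_apply, h3, smul_mul_assoc]
    · simp only [Pi.smul_apply, h4, mul_smul_comm]

/-- A Hilbert `A`-module: a right `A`-module with an `A`-valued inner product
`⟨·,·⟩`, linear in the second argument and with `⟨m, m'a⟩ = ⟨m, m'⟩a`, which is complete in the
norm `‖m‖ = ‖⟨m, m⟩‖ ^ (1/2)`. (Mathlib's `CStarModule` has left actions instead.) -/
class HilbertModule (A M : Type*) [NonUnitalCStarAlgebra A] [PartialOrder A]
    [NormedAddCommGroup M] [NormedSpace ℂ M] [SMul Aᵐᵒᵖ M]
    extends Inner A M, RightModule A M where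
  inner_add_right : ∀ m n k : M, inner m (n + k) = inner m n + inner m k
  inner_smul_right : ∀ (z : ℂ) (m n : M), inner m (z • n) = z • inner m n
  inner_act_right : ∀ (m n : M) (a : A), inner m (n <• a) = inner m n * a
  star_inner : ∀ m n : M, star (inner m n) = inner n m
  inner_self_nonneg : ∀ m : M, 0 ≤ inner m m
  inner_self_eq_zero : ∀ m : M, inner m m = 0 → m = 0
  norm_eq : ∀ m : M, ‖m‖ = √‖inner m m‖
  complete : CompleteSpace M

/-- A map between right `A`-modules commutes with the right action. Together with complex
linearity this is `A`-linearity. -/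
def IsALinear (A : Type*) {V W : Type*} [SMul Aᵐᵒᵖ V] [SMul Aᵐᵒᵖ W] (f : V → W) : Prop :=
  ∀ (v : V) (a : A), f (v <• a) = f v <• a

/-- A Hilbert module is self-dual if every bounded `A`-linear map `f : M → A` is of the form
`f = ⟨m, ·⟩`. -/
def IsSelfDual (A M : Type*) [NonUnitalCStarAlgebra A] [PartialOrder A]
    [NormedAddCommGroup M] [NormedSpace ℂ M] [SMul Aᵐᵒᵖ M] [HilbertModule A M] : Prop :=
  ∀ f : M →L[ℂ] A, (∀ (n : M) (a : A), f (n <• a) = f n * a) →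
    ∃ m : M, ∀ n : M, f n = inner A m n

/-! ### Adjointable operators -/

section Adjointable

variable (A M : Type*) [NonUnitalCStarAlgebra A] [PartialOrder A]
  [NormedAddCommGroup M] [NormedSpace ℂ M] [SMul Aᵐᵒᵖ M] [HilbertModule A M]

variable {A M} in
theorem HilbertModule.inner_add_left (m n k : M) :
    inner A (m + n) k = inner A m k + inner A n k := by
  rw [← HilbertModule.star_inner, HilbertModule.inner_add_right, star_add,
    HilbertModule.star_inner, HilbertModule.star_inner]

variable {A M} in
theorem HilbertModule.inner_smul_left (z : ℂ) (m n : M) :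
    inner A (z • m) n = star z • inner A m n := by
  rw [← HilbertModule.star_inner, HilbertModule.inner_smul_right, star_smul,
    HilbertModule.star_inner]

variable {A M} in
theorem HilbertModule.inner_act_left (m n : M) (a : A) :
    inner A (m <• a) n = star a * inner A m n := by
  rw [← HilbertModule.star_inner, HilbertModule.inner_act_right, star_mul,
    HilbertModule.star_inner]

variable {A M} in
theorem HilbertModule.ext_inner {m n : M} (h : ∀ k : M, inner A k m = inner A k n) : m = n := by
  have hz : ∀ k : M, inner A k (m - n) = 0 := fun k => by
    have h1 : m - n = m + (-1 : ℂ) • n := by rw [neg_one_smul, sub_eq_add_neg]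
    rw [h1, HilbertModule.inner_add_right, HilbertModule.inner_smul_right, h k]
    simp
  exact sub_eq_zero.mp (HilbertModule.inner_self_eq_zero _ (hz _))

/-- The bounded `A`-linear operators on `M` that have a bounded `A`-linear adjoint, as a
subalgebra of the bounded complex linear operators. -/
def adjointable : Subalgebra ℂ (M →L[ℂ] M) where
  carrier := {T | IsALinear A T ∧ ∃ T' : M →L[ℂ] M, IsALinear A T' ∧
    ∀ m n : M, inner A m (T n) = inner A (T' m) n}
  mul_mem' := by
    rintro S T ⟨hS, S', hS', hSS⟩ ⟨hT, T', hT', hTT⟩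
    refine ⟨fun v a => ?_, T' * S', fun v a => ?_, fun m n => ?_⟩
    · change S (T _) = S (T v) <• a
      rw [hT, hS]
    · change T' (S' _) = T' (S' v) <• a
      rw [hS', hT']
    · change inner A m (S (T n)) = inner A (T' (S' m)) n
      rw [hSS, hTT]
  add_mem' := by
    rintro S T ⟨hS, S', hS', hSS⟩ ⟨hT, T', hT', hTT⟩
    refine ⟨fun v a => ?_, S' + T', fun v a => ?_, fun m n => ?_⟩
    · change S _ + T _ = (S v + T v) <• a
      rw [hS, hT, RightModule.add_act]
    · change S' _ + T' _ = (S' v + T' v) <• a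
      rw [hS', hT', RightModule.add_act]
    · change inner A m (S n + T n) = inner A (S' m + T' m) n
      rw [HilbertModule.inner_add_right, HilbertModule.inner_add_left, hSS, hTT]
  algebraMap_mem' := by
    intro z
    refine ⟨fun v a => ?_, algebraMap ℂ _ (star z), fun v a => ?_, fun m n => ?_⟩
    · change z • (v <• a) = (z • v) <• a
      rw [RightModule.smul_act]
    · change star z • (v <• a) = (star z • v) <• a
      rw [RightModule.smul_act]
    · change inner A m (z • n) = inner A (star z • m) n
      rw [HilbertModule.inner_smul_right, HilbertModule.inner_smul_left, star_star]

/-- The *-algebra `L_A(M)` of adjointable operators on the Hilbert `A`-module `M`. -/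
abbrev AdjOp : Type _ := adjointable A M

variable {A M}

/-- The adjoint `T*`, determined by `⟨m, T n⟩ = ⟨T* m, n⟩`. -/
instance : Star (AdjOp A M) where
  star T := ⟨T.2.2.choose, T.2.2.choose_spec.1, T.1, T.2.1, fun m n => by
    rw [← HilbertModule.star_inner, ← T.2.2.choose_spec.2, HilbertModule.star_inner]⟩

theorem inner_adjOp (T : AdjOp A M) (m n : M) :
    inner A m (T.1 n) = inner A ((star T).1 m) n := T.2.2.choose_spec.2 m n

theorem inner_star_adjOp (T : AdjOp A M) (m n : M) :
    inner A m ((star T).1 n) = inner A (T.1 m) n := by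
  rw [← HilbertModule.star_inner, ← inner_adjOp, HilbertModule.star_inner]

theorem AdjOp.ext_inner {S T : AdjOp A M} (h : ∀ m n : M, inner A m (S.1 n) = inner A m (T.1 n)) :
    S = T :=
  Subtype.ext (ContinuousLinearMap.ext fun n => HilbertModule.ext_inner fun m => h m n)

instance : StarRing (AdjOp A M) where
  star_involutive T := AdjOp.ext_inner fun m n => by
    rw [inner_star_adjOp, inner_adjOp]
  star_mul S T := AdjOp.ext_inner fun m n => by
    change _ = inner A m ((star T).1 ((star S).1 n))
    rw [inner_star_adjOp, inner_star_adjOp, inner_star_adjOp]; rfl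
  star_add S T := AdjOp.ext_inner fun m n => by
    change _ = inner A m ((star S).1 n + (star T).1 n)
    rw [inner_star_adjOp, HilbertModule.inner_add_right, inner_star_adjOp, inner_star_adjOp,
      ← HilbertModule.inner_add_left]; rfl

/-- The usual operator order on `L_A(M)`: `S ≤ T` iff `⟨m, (T - S) m⟩ ≥ 0` for all `m`, which is
the same as `T - S = R* R` for some `R` in `L_A(M)`. -/
instance [StarOrderedRing A] : PartialOrder (AdjOp A M) where
  le S T := ∀ m : M, 0 ≤ inner A m ((T - S).1 m)
  le_refl S m := by
    have h : inner A m ((S - S).1 m) = (0 : A) := by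
      have h0 : (S - S).1 m = (0 : ℂ) • m := by simp
      rw [h0, HilbertModule.inner_smul_right, zero_smul]
    rw [h]
  le_trans S T R h k m := by
    have h1 : (R - S).1 m = (R - T).1 m + (T - S).1 m := by simp
    rw [h1, HilbertModule.inner_add_right]
    exact add_nonneg (k m) (h m)
  le_antisymm S T h k := by
    have hz : ∀ m : M, inner A m ((T - S).1 m) = (0 : A) := fun m => by
      refine le_antisymm ?_ (h m)
      have h1 : inner A m ((S - T).1 m) = -inner A m ((T - S).1 m) := by
        have h2 : (S - T).1 m = (-1 : ℂ) • (T - S).1 m := by simp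
        rw [h2, HilbertModule.inner_smul_right, neg_one_smul]
      have h3 := k m
      rw [h1] at h3
      exact neg_nonneg.mp h3
    symm
    rw [← sub_eq_zero]
    generalize T - S = D at hz
    refine AdjOp.ext_inner fun x y => ?_
    have e1 : inner A x (D.1 y) + inner A y (D.1 x) = (0 : A) := by
      have h4 := hz (x + y)
      rw [map_add, HilbertModule.inner_add_left, HilbertModule.inner_add_right,
        HilbertModule.inner_add_right, hz, hz] at h4
      simpa using h4
    have e2 : inner A x (D.1 y) - inner A y (D.1 x) = (0 : A) := by
      have h4 := hz (x + Complex.I • y)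
      rw [map_add, map_smul, HilbertModule.inner_add_left, HilbertModule.inner_add_right,
        HilbertModule.inner_add_right, HilbertModule.inner_smul_left,
        HilbertModule.inner_smul_left, HilbertModule.inner_smul_right,
        HilbertModule.inner_smul_right, hz, hz] at h4
      have h5 : Complex.I • (inner A x (D.1 y) - inner A y (D.1 x)) = (0 : A) := by
        rw [smul_sub]
        simpa [sub_eq_add_neg] using h4
      exact (smul_eq_zero.mp h5).resolve_left Complex.I_ne_zero
    have e3 : (2 : ℂ) • inner A x (D.1 y) = (0 : A) := by
      rw [two_smul]
      calc _ = (inner A x (D.1 y) + inner A y (D.1 x))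
            + (inner A x (D.1 y) - inner A y (D.1 x)) := by abel
        _ = 0 := by rw [e1, e2, add_zero]
    have h0 : (0 : AdjOp A M).1 y = (0 : ℂ) • y := by simp
    rw [h0, HilbertModule.inner_smul_right, zero_smul]
    exact (smul_eq_zero.mp e3).resolve_left two_ne_zero

variable (A M) in
/-- The sesquilinear form `(m, n) ↦ ⟨m, T n⟩` of an adjointable operator `T`, as a linear map
in `T`. -/
def formOfOp : AdjOp A M →ₗ[ℂ] SesqForm A M where
  toFun T := ⟨fun m n => inner A m (T.1 n), by
    refine ⟨fun u v w z => ?_, fun u v w z => ?_, fun u v a => ?_, fun u v a => ?_⟩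
    · change inner A u (T.1 (v + z • w)) = inner A u (T.1 v) + z • inner A u (T.1 w)
      rw [map_add, map_smul, HilbertModule.inner_add_right, HilbertModule.inner_smul_right]
    · change inner A (v + z • w) (T.1 u) = inner A v (T.1 u) + star z • inner A w (T.1 u)
      rw [HilbertModule.inner_add_left, HilbertModule.inner_smul_left]
    · change inner A u (T.1 (v <• a)) = inner A u (T.1 v) * a
      rw [T.2.1, HilbertModule.inner_act_right]
    · change inner A (u <• a) (T.1 v) = star a * inner A u (T.1 v)
      rw [HilbertModule.inner_act_left]⟩
  map_add' S T := Subtype.ext <| funext fun m => funext fun n =>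
    HilbertModule.inner_add_right m (S.1 n) (T.1 n)
  map_smul' z T := Subtype.ext <| funext fun m => funext fun n =>
    HilbertModule.inner_smul_right z m (T.1 n)

end Adjointable

/-! ### W*-algebras and their tensor product -/

/-- A presentation of `B` as a W*-algebra: a *-isomorphism of `B` onto a von Neumann algebra on
the Hilbert space `H` (such an isomorphism is automatically isometric, normal and unital). -/
structure WStarRep (B H : Type*) [NonUnitalCStarAlgebra B] [NormedAddCommGroup H]
    [InnerProductSpace ℂ H] [CompleteSpace H] where
  /-- the von Neumann algebra on `H` -/
  alg : VonNeumannAlgebra H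
  /-- the *-isomorphism -/
  iso : B ≃⋆ₐ[ℂ] alg.toStarSubalgebra

section Tensor

variable {H₁ H₂ : Type*} [NormedAddCommGroup H₁] [InnerProductSpace ℂ H₁]
  [NormedAddCommGroup H₂] [InnerProductSpace ℂ H₂]

/-- The Hilbert space tensor product. -/
abbrev HTensor (H₁ H₂ : Type*) [NormedAddCommGroup H₁] [InnerProductSpace ℂ H₁]
    [NormedAddCommGroup H₂] [InnerProductSpace ℂ H₂] : Type _ :=
  UniformSpace.Completion (H₁ ⊗[ℂ] H₂)

/-- The bounded operator `x ⊗ y` on the Hilbert space tensor product. -/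
def opTensor (x : H₁ →L[ℂ] H₁) (y : H₂ →L[ℂ] H₂) : HTensor H₁ H₂ →L[ℂ] HTensor H₁ H₂ :=
  (TensorProduct.mapL x y).completion

theorem opTensor_coe (x : H₁ →L[ℂ] H₁) (y : H₂ →L[ℂ] H₂) (t : H₁ ⊗[ℂ] H₂) :
    opTensor x y (t : HTensor H₁ H₂) = ((TensorProduct.mapL x y t : H₁ ⊗[ℂ] H₂) : HTensor H₁ H₂) :=
  UniformSpace.Completion.map_coe (TensorProduct.mapL x y).uniformContinuous t

theorem hTensor_ext {S T : HTensor H₁ H₂ →L[ℂ] HTensor H₁ H₂}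
    (h : ∀ t : H₁ ⊗[ℂ] H₂, S (t : HTensor H₁ H₂) = T (t : HTensor H₁ H₂)) : S = T :=
  ContinuousLinearMap.ext fun x => by
    induction x using UniformSpace.Completion.induction_on with
    | hp => exact isClosed_eq S.continuous T.continuous
    | ih t => exact h t

theorem opTensor_add_left (x x' : H₁ →L[ℂ] H₁) (y : H₂ →L[ℂ] H₂) :
    opTensor (x + x') y = opTensor x y + opTensor x' y :=
  hTensor_ext fun t => by
    rw [add_apply, opTensor_coe, opTensor_coe, opTensor_coe,
      TensorProduct.mapL_add_left, add_apply, UniformSpace.Completion.coe_add]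

theorem opTensor_add_right (x : H₁ →L[ℂ] H₁) (y y' : H₂ →L[ℂ] H₂) :
    opTensor x (y + y') = opTensor x y + opTensor x y' :=
  hTensor_ext fun t => by
    rw [add_apply, opTensor_coe, opTensor_coe, opTensor_coe,
      TensorProduct.mapL_add_right, add_apply, UniformSpace.Completion.coe_add]

theorem opTensor_smul_left (z : ℂ) (x : H₁ →L[ℂ] H₁) (y : H₂ →L[ℂ] H₂) :
    opTensor (z • x) y = z • opTensor x y :=
  hTensor_ext fun t => by
    rw [smul_apply, opTensor_coe, opTensor_coe,
      TensorProduct.mapL_smul_left, smul_apply,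
      UniformSpace.Completion.coe_smul]

theorem opTensor_smul_right (z : ℂ) (x : H₁ →L[ℂ] H₁) (y : H₂ →L[ℂ] H₂) :
    opTensor x (z • y) = z • opTensor x y :=
  hTensor_ext fun t => by
    rw [smul_apply, opTensor_coe, opTensor_coe,
      TensorProduct.mapL_smul_right, smul_apply,
      UniformSpace.Completion.coe_smul]

variable [CompleteSpace H₁] [CompleteSpace H₂] {B C : Type*} [CStarAlgebra B] [CStarAlgebra C]

/-- The set of all operators `b ⊗ c` on the Hilbert space tensor product. -/
def elementaryTensors (r₁ : WStarRep B H₁) (r₂ : WStarRep C H₂) :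
    Set (HTensor H₁ H₂ →L[ℂ] HTensor H₁ H₂) :=
  {T | ∃ (b : B) (c : C), T = opTensor (r₁.iso b).1 (r₂.iso c).1}

/-- The von Neumann algebra tensor product: the von Neumann algebra generated by the operators
`b ⊗ c`, that is, the double commutant of this self-adjoint set. (`StarSubalgebra.centralizer`
is the commutant of a set together with the adjoints of its elements.) -/
def tensorVN (r₁ : WStarRep B H₁) (r₂ : WStarRep C H₂) : VonNeumannAlgebra (HTensor H₁ H₂) where
  toStarSubalgebra := StarSubalgebra.centralizer ℂ
    (SetLike.coe (StarSubalgebra.centralizer ℂ (elementaryTensors r₁ r₂)))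
  centralizer_centralizer' := by
    change Set.centralizer (Set.centralizer (SetLike.coe (StarSubalgebra.centralizer ℂ
      (SetLike.coe (StarSubalgebra.centralizer ℂ (elementaryTensors r₁ r₂)))))) =
      SetLike.coe (StarSubalgebra.centralizer ℂ _)
    rw [StarSubalgebra.coe_centralizer, Set.centralizer_centralizer_centralizer]

/-- The W*-algebra `B ⊗ C` (the von Neumann algebra tensor product) as a *-algebra. -/
abbrev WTensor (r₁ : WStarRep B H₁) (r₂ : WStarRep C H₂) : Type _ :=
  (tensorVN r₁ r₂).toStarSubalgebra

/-- The element `b ⊗ c` of `B ⊗ C`. -/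
def WTensor.tmul (r₁ : WStarRep B H₁) (r₂ : WStarRep C H₂) (b : B) (c : C) : WTensor r₁ r₂ :=
  ⟨opTensor (r₁.iso b).1 (r₂.iso c).1, by
    change _ ∈ StarSubalgebra.centralizer ℂ _
    rw [StarSubalgebra.mem_centralizer_iff]
    intro T hT
    have hmem : opTensor (r₁.iso b).1 (r₂.iso c).1 ∈ elementaryTensors r₁ r₂ := ⟨b, c, rfl⟩
    have hT' : T ∈ StarSubalgebra.centralizer ℂ (elementaryTensors r₁ r₂) := hT
    have hT'' := star_mem hT'
    rw [StarSubalgebra.mem_centralizer_iff] at hT' hT''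
    exact ⟨((hT' _ hmem).1).symm, ((hT'' _ hmem).1).symm⟩⟩

/-- The linear map `b ↦ b ⊗ 1`. -/
def WTensor.inl (r₁ : WStarRep B H₁) (r₂ : WStarRep C H₂) : B →ₗ[ℂ] WTensor r₁ r₂ where
  toFun b := WTensor.tmul r₁ r₂ b 1
  map_add' b b' := Subtype.ext <| by
    change opTensor (r₁.iso (b + b')).1 _ = opTensor _ _ + opTensor _ _
    rw [map_add]; exact opTensor_add_left _ _ _
  map_smul' z b := Subtype.ext <| by
    change opTensor (r₁.iso (z • b)).1 _ = z • opTensor _ _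
    rw [map_smul]; exact opTensor_smul_left _ _ _

/-- The linear map `c ↦ 1 ⊗ c`. -/
def WTensor.inr (r₁ : WStarRep B H₁) (r₂ : WStarRep C H₂) : C →ₗ[ℂ] WTensor r₁ r₂ where
  toFun c := WTensor.tmul r₁ r₂ 1 c
  map_add' c c' := Subtype.ext <| by
    change opTensor _ (r₂.iso (c + c')).1 = opTensor _ _ + opTensor _ _
    rw [map_add]; exact opTensor_add_right _ _ _
  map_smul' z c := Subtype.ext <| by
    change opTensor _ (r₂.iso (z • c)).1 = z • opTensor _ _
    rw [map_smul]; exact opTensor_smul_right _ _ _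

/-- `δ` is the tensor product action `β ⊗ γ` on `B ⊗ C`: the action by *-automorphisms with
`δ_g (b ⊗ c) = β_g b ⊗ γ_g c`. (Since *-automorphisms of von Neumann algebras are normal and the
`b ⊗ c` generate `B ⊗ C`, there is exactly one such action for given `β` and `γ`.) -/
def IsTensorAction {G : Type*} [Group G] {r₁ : WStarRep B H₁} {r₂ : WStarRep C H₂}
    (β : G →* (B ≃⋆ₐ[ℂ] B)) (γ : G →* (C ≃⋆ₐ[ℂ] C))
    (δ : G →* (WTensor r₁ r₂ ≃⋆ₐ[ℂ] WTensor r₁ r₂)) : Prop :=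
  ∀ (g : G) (b : B) (c : C),
    δ g (WTensor.tmul r₁ r₂ b c) = WTensor.tmul r₁ r₂ (β g b) (γ g c)

end Tensor

/-! ### Normality -/

/-- A positive linear map is normal if it preserves the suprema of increasing nets (given here by
upward directed sets) of self-adjoint elements. -/
def IsNormalMap {X Y : Type*} [LE X] [Star X] [LE Y] (f : X → Y) : Prop :=
  ∀ s : Set X, s.Nonempty → DirectedOn (· ≤ ·) s → (∀ x ∈ s, IsSelfAdjoint x) →
    ∀ x : X, IsLUB s x → IsLUB (f '' s) (f x)

/-- Membership in the positive cone of the predual of the W*-algebra `A`: positive normal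
linear functionals. -/
def IsNormalPositive {A : Type*} [NonUnitalCStarAlgebra A] [PartialOrder A]
    (φ : A →ₗ[ℂ] ℂ) : Prop :=
  (∀ a : A, 0 ≤ a → 0 ≤ φ a) ∧ IsNormalMap φ

/-- Density in the topology `τ₁` given by the seminorms `p_φ(ℓ) = φ(⟨ℓ, ℓ⟩) ^ (1/2)`, `φ` a
positive normal functional on `A`. -/
def IsTauOneDense (A : Type*) {L : Type*} [NonUnitalCStarAlgebra A] [PartialOrder A]
    [NormedAddCommGroup L] [NormedSpace ℂ L] [SMul Aᵐᵒᵖ L] [HilbertModule A L]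
    (D : Set L) : Prop :=
  ∀ (l : L) (F : Finset (A →ₗ[ℂ] ℂ)), (∀ φ ∈ F, IsNormalPositive φ) → ∀ ε : ℝ, 0 < ε →
    ∃ d ∈ D, ∀ φ ∈ F, √(φ (inner A (l - d) (l - d))).re < ε

/-- Density in the topology `τ₂` given by the seminorms `p_{φ,ℓ'}(ℓ) = |φ(⟨ℓ', ℓ⟩)|`, `φ` a
positive normal functional on `A` and `ℓ' ∈ L`. -/
def IsTauTwoDense (A : Type*) {L : Type*} [NonUnitalCStarAlgebra A] [PartialOrder A]
    [NormedAddCommGroup L] [NormedSpace ℂ L] [SMul Aᵐᵒᵖ L] [HilbertModule A L]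
    (D : Set L) : Prop :=
  ∀ (l : L) (F : Finset ((A →ₗ[ℂ] ℂ) × L)), (∀ p ∈ F, IsNormalPositive p.1) → ∀ ε : ℝ, 0 < ε →
    ∃ d ∈ D, ∀ p ∈ F, ‖p.1 (inner A p.2 (l - d))‖ < ε

/-! ### Covariant completely positive maps and their dilations -/

section CP

variable {A V B G : Type*} [NonUnitalCStarAlgebra A] [PartialOrder A]
  [AddCommGroup V] [Module ℂ V] [SMul Aᵐᵒᵖ V] [Group G]

/-- Complete positivity of a linear map into `S_A(V)`. -/
def IsCP [Ring B] [StarRing B] [Module ℂ B] (S : B →ₗ[ℂ] SesqForm A V) : Prop :=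
  ∀ (n : ℕ) (b : Fin n → B) (v : Fin n → V),
    0 ≤ ∑ j, ∑ k, (S (star (b j) * b k)).1 (v j) (v k)

/-- Covariance: `S_{β_g(b)}(v, w) = S_b(U(g⁻¹)v, U(g⁻¹)w)`. -/
def IsCovariant [Ring B] [StarRing B] [Algebra ℂ B] (β : G →* (B ≃⋆ₐ[ℂ] B))
    (U : G →* (V ≃ₗ[ℂ] V)) (S : B →ₗ[ℂ] SesqForm A V) : Prop :=
  ∀ (g : G) (b : B) (v w : V), (S (β g b)).1 v w = (S b).1 (U g⁻¹ v) (U g⁻¹ w)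

/-- Normality of a CP map with values in `S_A(V)`: all the maps `b ↦ S_b(v, v)` are normal. -/
def IsNormalCP [CStarAlgebra B] [LE B] (S : B →ₗ[ℂ] SesqForm A V) : Prop :=
  ∀ v : V, IsNormalMap fun b : B => (S b).1 v v

variable {M : Type*} [NormedAddCommGroup M] [NormedSpace ℂ M] [SMul Aᵐᵒᵖ M] [HilbertModule A M]

/-- Complete positivity of a linear map `F` into `L_A(M)`: the map `d ↦ ⟨·, F(d) ·⟩` into
`S_A(M)` is completely positive. -/
def IsCPOp [CStarAlgebra B] (F : B →ₗ[ℂ] AdjOp A M) : Prop :=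
  IsCP ((formOfOp A M).comp F)

variable [CStarAlgebra B]

/-- The conditions common to the two kinds of minimal covariant dilations `(M, π, J, Ũ)` of a
covariant CP map `S`. -/
structure IsCovariantDilation (S : B →ₗ[ℂ] SesqForm A V) (β : G →* (B ≃⋆ₐ[ℂ] B))
    (U : G →* (V ≃ₗ[ℂ] V)) (π : B →⋆ₐ[ℂ] AdjOp A M) (J : V →ₗ[ℂ] M)
    (Ut : G →* unitary (AdjOp A M)) : Prop where
  linear : IsALinear A J
  form : ∀ (b : B) (v w : V), (S b).1 v w = inner A (J v) ((π b).1 (J w))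
  intertwine : ∀ (g : G) (v : V), J (U g v) = (Ut g).1.1 (J v)
  covariant : ∀ (g : G) (b : B), (Ut g).1 * π b = π (β g b) * (Ut g).1

/-- The complex linear span of the vectors `π(b)Jv`. -/
def dilationSpan (π : B →⋆ₐ[ℂ] AdjOp A M) (J : V →ₗ[ℂ] M) : Set M :=
  (Submodule.span ℂ {m : M | ∃ (b : B) (v : V), m = (π b).1 (J v)} : Submodule ℂ M)

/-- A minimal `(β, U)`-covariant dilation of `S`. -/
structure IsMinimalDilation (S : B →ₗ[ℂ] SesqForm A V) (β : G →* (B ≃⋆ₐ[ℂ] B))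
    (U : G →* (V ≃ₗ[ℂ] V)) (π : B →⋆ₐ[ℂ] AdjOp A M) (J : V →ₗ[ℂ] M)
    (Ut : G →* unitary (AdjOp A M)) : Prop extends IsCovariantDilation S β U π J Ut where
  dense : Dense (dilationSpan π J)

/-- A W*-minimal `(β, U)`-covariant dilation of `S`, for `A` a W*-algebra. The density may be
taken in either of the topologies `τ₁` and `τ₂`. -/
structure IsWStarMinimalDilation (S : B →ₗ[ℂ] SesqForm A V) (β : G →* (B ≃⋆ₐ[ℂ] B))
    (U : G →* (V ≃ₗ[ℂ] V)) (π : B →⋆ₐ[ℂ] AdjOp A M) (J : V →ₗ[ℂ] M)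
    (Ut : G →* unitary (AdjOp A M)) : Prop extends IsCovariantDilation S β U π J Ut where
  selfDual : IsSelfDual A M
  dense : IsTauOneDense A (dilationSpan π J) ∨ IsTauTwoDense A (dilationSpan π J)

variable {C H₁ H₂ : Type*} [CStarAlgebra C]
  [NormedAddCommGroup H₁] [InnerProductSpace ℂ H₁] [CompleteSpace H₁]
  [NormedAddCommGroup H₂] [InnerProductSpace ℂ H₂] [CompleteSpace H₂]
  {r₁ : WStarRep B H₁} {r₂ : WStarRep C H₂}

/-- The first marginal `S¹_b = S_{b ⊗ 1}`. -/
def marginalOne (S : WTensor r₁ r₂ →ₗ[ℂ] SesqForm A V) : B →ₗ[ℂ] SesqForm A V :=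
  S.comp (WTensor.inl r₁ r₂)

/-- The second marginal `S²_c = S_{1 ⊗ c}`. -/
def marginalTwo (S : WTensor r₁ r₂ →ₗ[ℂ] SesqForm A V) : C →ₗ[ℂ] SesqForm A V :=
  S.comp (WTensor.inr r₁ r₂)

/-- `E : C → L_A(M)` is a CP map which is covariant with respect to `Ũ` and `γ`, commutes with
`π`, and satisfies `S_{b ⊗ c}(v, w) = ⟨Kv, π(b)E(c)Kw⟩`. -/
structure IsSubminimal (S : WTensor r₁ r₂ →ₗ[ℂ] SesqForm A V) (γ : G →* (C ≃⋆ₐ[ℂ] C))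
    (π : B →⋆ₐ[ℂ] AdjOp A M) (K : V →ₗ[ℂ] M) (Ut : G →* unitary (AdjOp A M))
    (E : C →ₗ[ℂ] AdjOp A M) : Prop where
  cp : IsCPOp E
  covariant : ∀ (g : G) (c : C), (Ut g).1 * E c = E (γ g c) * (Ut g).1
  commute : ∀ (b : B) (c : C), π b * E c = E c * π b
  form : ∀ (b : B) (c : C) (v w : V),
    (S (WTensor.tmul r₁ r₂ b c)).1 v w = inner A (K v) ((π b * E c).1 (K w))

end CP

end CovKSGNS

end

open CovKSGNS

/-! Everything is encoded in matrix elements on the vectors π(b)Kv. If E exists, its commutation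
with π forces ⟨π(b)Kv | E(c)π(b')Kv'⟩ = S_{b*b'⊗c}(v,v'), the `tensorKernel`. As soon as only 0 is
orthogonal to all π(b)Kv (`IsSeparating`), an adjointable operator is determined by these elements.
Uniqueness, E(1) = 1, covariance and commutation then reduce to identities between kernels;
existence, complete positivity and normality are what needs analysis.

Existence is a Radon–Nikodym argument. For 0 ≤ c ≤ ‖c‖1, complete positivity of S makes the kernel
of c positive and dominated by ‖c‖ times the kernel of 1, and the latter is the Gram kernel of the
vectors π(b)Kv. In (a) their span is norm dense, so the kernel extends to a bounded A-sesquilinear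
form on M, which self-duality turns into an adjointable operator (`exists_adjOp_of_dense`). Positive
elements span C, and separation makes the result linear in c.

In (b) the span need not be norm dense. The argument moves to the interior tensor product X = L ⊗_A
H, where A acts faithfully on H. An operator on X that commutes with 1 ⊗ u for all u in the
commutant of A has A-valued matrix elements by the bicommutant property, and self-duality descends
it to an adjointable operator on L (`IsInvariant.exists_adjOp`). Applied to the projection onto the
closed span of the vectors π(b)Kv ⊗ ξ, this shows that they are total in X
(`dense_span_of_separating`). The domination argument now runs in X with scalar kernels, giving T :
C → B(X), and T descends to E.

For normality, let a bounded increasing net of elements a have supremum c. The operators T(a) have a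
weak limit T₀ ≤ T(c). If S² is normal, T₀ and T(c) agree on Kv ⊗ ξ, and then everywhere because left
factors b can be moved across the kernel. Conversely T₀ is invariant and descends to an upper bound
E₀ of the E(a); normality of E gives E(c) ≤ E₀, to be evaluated at Kv. -/

noncomputable section

namespace CovKSGNS

open scoped InnerProductSpace
open Filter Topology

/-! ### Bounded sesquilinear forms -/

section Sesq

variable {E M F : Type*} [AddCommGroup E] [Module ℂ E] [NormedAddCommGroup M] [NormedSpace ℂ M]
  [NormedAddCommGroup F] [NormedSpace ℂ F]

/-- A sesquilinear map is bounded by its quadratic form (polarization). -/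
theorem norm_sesq_le (b : E →ₗ⋆[ℂ] E →ₗ[ℂ] F) (q : E →ₗ[ℂ] M) {C : ℝ} (hC : 0 ≤ C)
    (h : ∀ x, ‖b x x‖ ≤ C * ‖q x‖ ^ 2) (x y : E) : ‖b x y‖ ≤ 4 * C * ‖q x‖ * ‖q y‖ := by
  have key : ∀ x y, ‖b x y‖ ≤ C * (‖q x‖ + ‖q y‖) ^ 2 := by
    intro x y
    have hpol : (4 : ℂ) • b x y = b (x + y) (x + y) - b (x - y) (x - y)
        - Complex.I • b (x + Complex.I • y) (x + Complex.I • y)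
        + Complex.I • b (x - Complex.I • y) (x - Complex.I • y) := by
      simp only [map_add, map_sub, LinearMap.add_apply, LinearMap.sub_apply, map_smulₛₗ,
        LinearMap.smul_apply, smul_add, smul_sub, smul_smul, Complex.conj_I, RingHom.id_apply]
      simp only [mul_neg, Complex.I_mul_I, neg_neg, neg_smul, one_smul]
      module
    have hn : ∀ z : E, ‖q z‖ ≤ ‖q x‖ + ‖q y‖ → ‖b z z‖ ≤ C * (‖q x‖ + ‖q y‖) ^ 2 := fun z hz =>
      (h z).trans (by gcongr)
    have hI : ‖q (Complex.I • y)‖ = ‖q y‖ := by rw [map_smul, norm_smul]; simp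
    have h1 := hn (x + y) (by rw [map_add]; exact norm_add_le _ _)
    have h2 := hn (x - y) (by rw [map_sub]; exact norm_sub_le _ _)
    have h3 := hn (x + Complex.I • y) (by rw [map_add, ← hI]; exact norm_add_le _ _)
    have h4 := hn (x - Complex.I • y) (by rw [map_sub, ← hI]; exact norm_sub_le _ _)
    have h5 : 4 * ‖b x y‖ = ‖(4 : ℂ) • b x y‖ := by rw [norm_smul]; simp
    have h6 : ‖(4 : ℂ) • b x y‖ ≤ ‖b (x + y) (x + y)‖ + ‖b (x - y) (x - y)‖
        + ‖b (x + Complex.I • y) (x + Complex.I • y)‖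
        + ‖b (x - Complex.I • y) (x - Complex.I • y)‖ := by
      rw [hpol]
      refine (norm_add_le _ _).trans (add_le_add ((norm_sub_le _ _).trans
        (add_le_add (norm_sub_le _ _) ?_)) ?_) <;> rw [norm_smul] <;> simp
    linarith
  -- Cross-scaling x by ‖q y‖ + ε and y by ‖q x‖ + ε balances the two arguments and turns the
  -- squared sum in `key` into a product; ε > 0 admits vectors on which q vanishes.
  have hε : ∀ ε : ℝ, 0 < ε → ‖b x y‖ ≤ 4 * C * (‖q x‖ + ε) * (‖q y‖ + ε) := by
    intro ε hε
    have hx : 0 < ‖q x‖ + ε := by positivity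
    have hy : 0 < ‖q y‖ + ε := by positivity
    have h1 := key (((‖q y‖ + ε : ℝ) : ℂ) • x) (((‖q x‖ + ε : ℝ) : ℂ) • y)
    simp only [map_smulₛₗ, LinearMap.smul_apply, norm_smul, RCLike.norm_conj, Complex.norm_real,
      Real.norm_of_nonneg hx.le, Real.norm_of_nonneg hy.le, RingHom.id_apply] at h1
    have h2 : C * ((‖q y‖ + ε) * ‖q x‖ + (‖q x‖ + ε) * ‖q y‖) ^ 2
        ≤ C * (2 * ((‖q x‖ + ε) * (‖q y‖ + ε))) ^ 2 := by
      have := norm_nonneg (q x)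
      have := norm_nonneg (q y)
      gcongr
      nlinarith
    have h3 : ((‖q x‖ + ε) * (‖q y‖ + ε)) * ‖b x y‖ ≤
        ((‖q x‖ + ε) * (‖q y‖ + ε)) * (4 * C * (‖q x‖ + ε) * (‖q y‖ + ε)) := by
      nlinarith [h1.trans h2]
    exact le_of_mul_le_mul_left h3 (by positivity)
  have hlim : Tendsto (fun ε : ℝ => 4 * C * (‖q x‖ + ε) * (‖q y‖ + ε)) (𝓝[>] 0)
      (𝓝 (4 * C * (‖q x‖ + 0) * (‖q y‖ + 0))) :=
    ((by fun_prop : Continuous fun ε : ℝ => 4 * C * (‖q x‖ + ε) * (‖q y‖ + ε)).tendsto 0).mono_left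
      nhdsWithin_le_nhds
  simpa using ge_of_tendsto hlim (eventually_mem_nhdsWithin.mono fun ε h => hε ε h)

/-- A kernel on a family with dense span whose quadratic form is bounded by the norm extends to a
bounded sesquilinear form. -/
theorem exists_sesq_extension [CompleteSpace F] {ι : Type*} (x : ι → M)
    (hx : Dense (Submodule.span ℂ (Set.range x) : Set M)) (k : ι → ι → F) {C : ℝ} (hC : 0 ≤ C)
    (hk : ∀ (s : Finset ι) (z : ι → ℂ),
      ‖∑ i ∈ s, ∑ j ∈ s, (star (z i) * z j) • k i j‖ ≤ C * ‖∑ i ∈ s, z i • x i‖ ^ 2) :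
    ∃ t : M →L⋆[ℂ] M →L[ℂ] F, ∀ i j, t (x i) (x j) = k i j := by
  -- The form is first defined on formal combinations, which q evaluates in M. The bound by ‖q f‖ ‖q
  -- g‖ lets it pass to M, one variable at a time.
  let q : (ι →₀ ℂ) →ₗ[ℂ] M := Finsupp.linearCombination ℂ x
  let b : (ι →₀ ℂ) →ₗ⋆[ℂ] (ι →₀ ℂ) →ₗ[ℂ] F := LinearMap.mk₂'ₛₗ (starRingEnd ℂ) (RingHom.id ℂ)
    (fun f g => f.sum fun i a => g.sum fun j c => (star a * c) • k i j)
    (fun f f' g => by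
      rw [Finsupp.sum_add_index'] <;> intros <;> simp [add_mul, add_smul, Finsupp.sum_add])
    (fun z f g => by
      rw [Finsupp.sum_smul_index] <;> simp [Finsupp.smul_sum, smul_smul, mul_assoc])
    (fun f g g' => by
      rw [← Finsupp.sum_add]
      refine Finsupp.sum_congr fun i _ => ?_
      rw [Finsupp.sum_add_index'] <;> intros <;> simp [mul_add, add_smul])
    (fun z f g => by
      rw [Finsupp.smul_sum]
      refine Finsupp.sum_congr fun i _ => ?_
      rw [Finsupp.sum_smul_index, Finsupp.smul_sum] <;> simp [smul_smul, mul_left_comm])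
  have hb : ∀ f g, ‖b f g‖ ≤ 4 * C * ‖q f‖ * ‖q g‖ := norm_sesq_le b q hC fun f => hk f.support f
  have hq : DenseRange q := by
    have : Set.range q = (Submodule.span ℂ (Set.range x) : Set M) := by
      rw [← Finsupp.range_linearCombination]; rfl
    rw [DenseRange, this]; exact hx
  have hb1 : ∀ f, ∃ C, ∀ g, ‖b f g‖ ≤ C * ‖q g‖ := fun f => ⟨_, hb f⟩
  let b1 : (ι →₀ ℂ) →ₗ⋆[ℂ] M →L[ℂ] F :=
    { toFun := fun f => (b f).extendOfNorm q
      map_add' := fun f f' => by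
        refine LinearMap.extendOfNorm_unique hq _ (hb (f + f')) _ ?_
        refine LinearMap.ext fun g => ?_
        simp [LinearMap.extendOfNorm_eq hq (hb1 _)]
      map_smul' := fun z f => by
        refine LinearMap.extendOfNorm_unique hq _ (hb (z • f)) _ ?_
        refine LinearMap.ext fun g => ?_
        simp [LinearMap.extendOfNorm_eq hq (hb1 _)] }
  have hb2 : ∃ C', ∀ f, ‖b1 f‖ ≤ C' * ‖q f‖ := ⟨4 * C, fun f =>
    LinearMap.opNorm_extendOfNorm_le hq (by positivity) (hb f)⟩
  refine ⟨b1.extendOfNorm q, fun i j => ?_⟩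
  have hs : ∀ i, q (Finsupp.single i 1) = x i := fun i => by simp [q]
  rw [← hs, ← hs, LinearMap.extendOfNorm_eq hq hb2]
  change (b _).extendOfNorm q _ = _
  rw [LinearMap.extendOfNorm_eq hq (hb1 _)]
  simp [b]

/-- Nonnegativity of a matrix of continuous sesquilinear forms may be tested on a total set. -/
theorem sum_sesq_nonneg_of_dense [PartialOrder F] [OrderClosedTopology F] {n : ℕ}
    (t : Fin n → Fin n → M →ₗ⋆[ℂ] M →ₗ[ℂ] F)
    (ht : ∀ j k, Continuous fun p : M × M => t j k p.1 p.2) {I : Type*} (x : I → M)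
    (hx : Dense (Submodule.span ℂ (Set.range x) : Set M))
    (h : ∀ (s : Finset (Fin n × I)) (z : Fin n × I → ℂ),
      0 ≤ ∑ p ∈ s, ∑ r ∈ s, t p.1 r.1 (z p • x p.2) (z r • x r.2))
    (m : Fin n → M) : 0 ≤ ∑ j, ∑ k, t j k (m j) (m k) := by
  classical
  have hcl : IsClosed {m : Fin n → M | 0 ≤ ∑ j, ∑ k, t j k (m j) (m k)} := by
    refine isClosed_le continuous_const ?_
    refine continuous_finsetSum _ fun j _ => continuous_finsetSum _ fun k _ => ?_
    exact (ht j k).comp (f := fun m : Fin n → M => (m j, m k))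
      ((continuous_apply j).prodMk (continuous_apply k))
  have hd : Dense {m : Fin n → M | ∀ j, m j ∈ (Submodule.span ℂ (Set.range x) : Set M)} := by
    have := dense_pi Set.univ fun (_ : Fin n) (_ : _ ∈ Set.univ) => hx
    simpa [Set.pi] using this
  refine (hcl.closure_subset_iff.mpr ?_) (hd m)
  intro m hm
  choose f hf using fun j => Finsupp.mem_span_range_iff_exists_finsupp.mp (hm j)
  let T : Finset I := Finset.univ.biUnion fun j => (f j).support
  have hm' : ∀ j, m j = ∑ i ∈ T, f j i • x i := fun j => by
    rw [← hf j]
    exact Finsupp.sum_of_support_subset _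
      (Finset.subset_biUnion_of_mem (fun j => (f j).support) (Finset.mem_univ j)) _ (by simp)
  have := h (Finset.univ ×ˢ T) fun p => f p.1 p.2
  simp only [Finset.sum_product] at this
  refine this.trans_eq ?_
  refine Finset.sum_congr rfl fun j _ => ?_
  rw [Finset.sum_comm]
  refine Finset.sum_congr rfl fun k _ => ?_
  rw [hm' j, hm' k]
  simp only [map_sum, LinearMap.sum_apply]
  rw [Finset.sum_comm]

end Sesq

/-! ### Hilbert modules -/

section HilbertModule

variable {A M : Type*} [NonUnitalCStarAlgebra A] [PartialOrder A]
  [NormedAddCommGroup M] [NormedSpace ℂ M] [SMul Aᵐᵒᵖ M] [HilbertModule A M]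

theorem HilbertModule.norm_sq (m : M) : ‖m‖ ^ 2 = ‖inner A m m‖ := by
  rw [HilbertModule.norm_eq (A := A) m, Real.sq_sqrt (norm_nonneg _)]

variable (A M) in
/-- The inner product of a Hilbert module as a sesquilinear map. -/
def innerSesq : M →ₗ⋆[ℂ] M →ₗ[ℂ] A :=
  LinearMap.mk₂'ₛₗ (starRingEnd ℂ) (RingHom.id ℂ) (fun m n => inner A m n)
    HilbertModule.inner_add_left HilbertModule.inner_smul_left
    HilbertModule.inner_add_right HilbertModule.inner_smul_right

/-- Polarization stands in for Cauchy–Schwarz. The constant 4 is harmless, since only joint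
continuity of the inner product is drawn from it. -/
theorem norm_inner_le_four (m n : M) : ‖inner A m n‖ ≤ 4 * ‖m‖ * ‖n‖ := by
  have := norm_sesq_le (innerSesq A M) LinearMap.id (C := 1) zero_le_one (fun x => by
    rw [one_mul]; exact (HilbertModule.norm_sq (A := A) x).ge) m n
  rwa [mul_one] at this

theorem continuous_inner_hilbertModule : Continuous fun p : M × M => inner A p.1 p.2 := by
  let t : M →L⋆[ℂ] M →L[ℂ] A := LinearMap.mkContinuous₂ (innerSesq A M) 4 norm_inner_le_four
  have : Continuous fun p : M × M => t p.1 p.2 := by fun_prop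
  exact this

theorem inner_zero_right_hilbertModule (m : M) : inner A m (0 : M) = 0 :=
  (innerSesq A M m).map_zero

theorem inner_sub_right_hilbertModule (m n k : M) :
    inner A m (n - k) = inner A m n - inner A m k :=
  (innerSesq A M m).map_sub n k

theorem inner_sub_left_hilbertModule (m n k : M) :
    inner A (m - n) k = inner A m k - inner A n k := by
  rw [← HilbertModule.star_inner, inner_sub_right_hilbertModule, star_sub,
    HilbertModule.star_inner, HilbertModule.star_inner]

theorem ext_inner_left_hilbertModule {m n : M} (h : ∀ k : M, inner A m k = inner A n k) :
    m = n :=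
  HilbertModule.ext_inner (A := A) fun k => by
    rw [← HilbertModule.star_inner, h, HilbertModule.star_inner]

/-- A Riesz representation: on a self-dual module, a bounded family of functionals that is
additive and conjugate homogeneous and compatible with `A` comes from a bounded operator. -/
theorem exists_clm_of_selfDual (hM : IsSelfDual A M) (s : SesqForm A M) {C : ℝ}
    (hs : ∀ m n, ‖s.1 m n‖ ≤ C * ‖m‖ * ‖n‖) :
    ∃ T : M →L[ℂ] M, IsALinear A T ∧ ∀ m n, inner A (T m) n = s.1 m n := by
  obtain ⟨h1, h2, h3, h4⟩ := s.2
  have hz : ∀ m, s.1 m 0 = 0 := fun m => by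
    have := h1 m 0 0 1
    simpa using this
  have hf : ∀ m, ∃ m', ∀ n, s.1 m n = inner A m' n := fun m => by
    let f : M →ₗ[ℂ] A :=
      { toFun := s.1 m
        map_add' := fun v w => by have := h1 m v w 1; simpa using this
        map_smul' := fun z v => by have := h1 m 0 v z; simpa [hz] using this }
    exact hM (f.mkContinuous (C * ‖m‖) (hs m)) fun n a => h3 m n a
  choose T hT using hf
  let T' : M →ₗ[ℂ] M :=
    { toFun := T
      map_add' := fun v w => ext_inner_left_hilbertModule (A := A) fun k => by
        rw [HilbertModule.inner_add_left, ← hT, ← hT, ← hT]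
        have := h2 k v w 1
        simpa using this
      map_smul' := fun z v => ext_inner_left_hilbertModule (A := A) fun k => by
        rw [RingHom.id_apply, HilbertModule.inner_smul_left, ← hT, ← hT]
        have h0 := h2 k 0 0 1
        have := h2 k 0 v z
        have h00 : s.1 0 k = 0 := by simpa using h0
        simpa [h00] using this }
  refine ⟨T'.mkContinuous C fun m => ?_, fun v a => ?_, fun m n => (hT m n).symm⟩
  · change ‖T m‖ ≤ _
    -- The sign of C is not assumed: where T m = 0, the inequality 0 ≤ C‖m‖ is extracted from the
    -- bound on s. Otherwise ‖T m‖² = ‖s(m, T m)‖ ≤ C‖m‖‖T m‖.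
    rcases eq_or_ne (T m) 0 with h0 | h0
    · rw [h0, norm_zero]
      rcases eq_or_ne m 0 with hm | hm
      · simp [hm]
      · have := (norm_nonneg _).trans (hs m m)
        have hp : 0 < ‖m‖ := norm_pos_iff.mpr hm
        exact nonneg_of_mul_nonneg_left this hp
    · have hp : 0 < ‖T m‖ := norm_pos_iff.mpr h0
      refine le_of_mul_le_mul_right ?_ hp
      rw [← sq, HilbertModule.norm_sq (A := A), ← hT]
      exact hs m (T m)
  · refine ext_inner_left_hilbertModule (A := A) fun k => ?_
    change inner A (T (v <• a)) k = inner A (T v <• a) k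
    rw [HilbertModule.inner_act_left, ← hT, ← hT, h4]

/-- The form `(m, n) ↦ s(n, m)*`. -/
def flipForm {V : Type*} [AddCommGroup V] [Module ℂ V] [SMul Aᵐᵒᵖ V] (s : SesqForm A V) :
    SesqForm A V :=
  ⟨fun m n => star (s.1 n m), by
    obtain ⟨h1, h2, h3, h4⟩ := s.2
    refine ⟨fun u v w z => ?_, fun u v w z => ?_, fun u v a => ?_, fun u v a => ?_⟩
    · simp [h2]
    · simp [h1]
    · simp [h4]
    · simp [h3]⟩

/-- On a self-dual Hilbert module every bounded sesquilinear form is given by an adjointable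
operator. -/
theorem exists_adjOp_of_sesqForm (hM : IsSelfDual A M) (s : SesqForm A M) {C : ℝ}
    (hs : ∀ m n, ‖s.1 m n‖ ≤ C * ‖m‖ * ‖n‖) :
    ∃ T : AdjOp A M, ∀ m n, inner A m (T.1 n) = s.1 m n := by
  obtain ⟨T', hT', h'⟩ := exists_clm_of_selfDual hM s hs
  -- The Riesz representation places the operator in the left slot, so s itself yields the adjoint
  -- and the flipped form yields the operator.
  obtain ⟨T, hT, h⟩ := exists_clm_of_selfDual hM (flipForm s) (C := C) (fun m n => by
    change ‖star (s.1 n m)‖ ≤ _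
    rw [norm_star, mul_right_comm]; exact hs n m)
  have key : ∀ m n, inner A m (T n) = s.1 m n := fun m n => by
    rw [← HilbertModule.star_inner, h]
    exact star_star _
  exact ⟨⟨T, hT, T', hT', fun m n => by rw [key, h']⟩, key⟩

end HilbertModule

/-! ### Elementary tensors -/

section Tensor

variable {H₁ H₂ : Type*} [NormedAddCommGroup H₁] [InnerProductSpace ℂ H₁]
  [NormedAddCommGroup H₂] [InnerProductSpace ℂ H₂]

theorem opTensor_mul (x x' : H₁ →L[ℂ] H₁) (y y' : H₂ →L[ℂ] H₂) :
    opTensor x y * opTensor x' y' = opTensor (x * x') (y * y') :=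
  hTensor_ext fun t => by
    change opTensor x y (opTensor x' y' t) = _
    rw [opTensor_coe, opTensor_coe, opTensor_coe, TensorProduct.mapL_mul]
    rfl

variable [CompleteSpace H₁] [CompleteSpace H₂]

theorem star_opTensor (x : H₁ →L[ℂ] H₁) (y : H₂ →L[ℂ] H₂) :
    star (opTensor x y) = opTensor (star x) (star y) := by
  symm
  refine (ContinuousLinearMap.eq_adjoint_iff _ _).mpr fun s t => ?_
  induction s, t using UniformSpace.Completion.induction_on₂ with
  | hp => exact isClosed_eq (by fun_prop) (by fun_prop)
  | ih s t =>
    rw [opTensor_coe, opTensor_coe, UniformSpace.Completion.inner_coe,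
      UniformSpace.Completion.inner_coe]
    induction s with
    | zero => simp
    | add a b ha hb => rw [map_add, inner_add_left, inner_add_left, ha, hb]
    | tmul a b =>
      induction t with
      | zero => simp
      | add c d hc hd => rw [map_add, inner_add_right, inner_add_right, hc, hd]
      | tmul c d =>
        rw [TensorProduct.mapL_tmul, TensorProduct.mapL_tmul, TensorProduct.inner_tmul,
          TensorProduct.inner_tmul, ContinuousLinearMap.star_eq_adjoint,
          ContinuousLinearMap.star_eq_adjoint, ContinuousLinearMap.adjoint_inner_left,
          ContinuousLinearMap.adjoint_inner_left]

variable {B C : Type*} [CStarAlgebra B] [CStarAlgebra C] (r₁ : WStarRep B H₁) (r₂ : WStarRep C H₂)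

theorem WTensor.star_tmul_mul_tmul (b b' : B) (c c' : C) :
    star (WTensor.tmul r₁ r₂ b c) * WTensor.tmul r₁ r₂ b' c' =
      WTensor.tmul r₁ r₂ (star b * b') (star c * c') := by
  refine Subtype.ext ?_
  change star (opTensor _ _) * opTensor _ _ = opTensor (r₁.iso _).1 (r₂.iso _).1
  rw [map_mul, map_mul, map_star, map_star, star_opTensor, opTensor_mul]
  rfl

/-- The linear map `c ↦ b ⊗ c`. -/
def WTensor.tmulRight (b : B) : C →ₗ[ℂ] WTensor r₁ r₂ where
  toFun c := WTensor.tmul r₁ r₂ b c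
  map_add' c c' := Subtype.ext <| by
    change opTensor _ (r₂.iso (c + c')).1 = opTensor _ _ + opTensor _ _
    rw [map_add]; exact opTensor_add_right _ _ _
  map_smul' z c := Subtype.ext <| by
    change opTensor _ (r₂.iso (z • c)).1 = z • opTensor _ _
    rw [map_smul]; exact opTensor_smul_right _ _ _

end Tensor

/-! ### Completely positive maps -/

section CP

variable {A V D : Type*} [NonUnitalCStarAlgebra A]
  [AddCommGroup V] [Module ℂ V] [SMul Aᵐᵒᵖ V]

theorem SesqForm.apply_smul_right (s : SesqForm A V) (z : ℂ) (u v : V) :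
    s.1 u (z • v) = z • s.1 u v := by
  have h0 : s.1 u 0 = 0 := by simpa using s.2.1 u 0 0 1
  simpa [h0] using s.2.1 u 0 v z

theorem SesqForm.apply_smul_left (s : SesqForm A V) (z : ℂ) (u v : V) :
    s.1 (z • v) u = star z • s.1 v u := by
  have h0 : s.1 0 u = 0 := by simpa using s.2.2.1 u 0 0 1
  simpa [h0] using s.2.2.1 u 0 v z

theorem SesqForm.apply_act_right (s : SesqForm A V) (u v : V) (a : A) :
    s.1 u (v <• a) = s.1 u v * a := s.2.2.2.1 u v a

theorem SesqForm.apply_act_left (s : SesqForm A V) (u v : V) (a : A) :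
    s.1 (u <• a) v = star a * s.1 u v := s.2.2.2.2 u v a

variable [PartialOrder A] [Ring D] [StarRing D] [Module ℂ D] {S : D →ₗ[ℂ] SesqForm A V}

theorem IsCP.sum_nonneg (hS : IsCP S) {ι : Type*} (s : Finset ι) (d : ι → D) (v : ι → V) :
    0 ≤ ∑ i ∈ s, ∑ j ∈ s, (S (star (d i) * d j)).1 (v i) (v j) := by
  let e := s.equivFin
  have h := hS s.card (fun k => d (e.symm k)) (fun k => v (e.symm k))
  rw [e.symm.sum_comp (fun i : s => ∑ k, (S (star (d i) * d (e.symm k))).1 (v i) (v (e.symm k)))]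
    at h
  simp_rw [fun i : s =>
    e.symm.sum_comp (fun j : s => (S (star (d i) * d j)).1 (v i) (v j))] at h
  rw [← Finset.sum_coe_sort]
  simp_rw [← Finset.sum_coe_sort s fun j => _]
  exact h

/-- Positive matrices are hermitian: removing the diagonal terms from the positive 2×2 sum at (v,
zv') leaves a selfadjoint cross term, and z = 1 and z = i separate its two halves. -/
theorem IsCP.star_apply [StarOrderedRing A] (hS : IsCP S) (d d' : D) (v v' : V) :
    star ((S (star d * d')).1 v v') = (S (star d' * d)).1 v' v := by
  have h : ∀ z : ℂ, star (z • (S (star d * d')).1 v v' + star z • (S (star d' * d)).1 v' v) =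
      z • (S (star d * d')).1 v v' + star z • (S (star d' * d)).1 v' v := by
    intro z
    have h1 := hS 1 ![d] ![v]
    have h2 := hS 1 ![d'] ![z • v']
    have h3 := hS 2 ![d, d'] ![v, z • v']
    simp only [Fin.sum_univ_two, Fin.sum_univ_one, Matrix.cons_val_zero, Matrix.cons_val_one,
      SesqForm.apply_smul_right, SesqForm.apply_smul_left] at h1 h2 h3
    have h1' := (IsSelfAdjoint.of_nonneg h1)
    have h2' := (IsSelfAdjoint.of_nonneg h2)
    have h3' := (IsSelfAdjoint.of_nonneg h3)
    have := (h3'.sub h1').sub h2'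
    convert this.star_eq using 2 <;> abel
  have e1 := h 1
  have e2 := h Complex.I
  simp only [one_smul, star_one, star_add, star_smul, RCLike.star_def,
    Complex.conj_I, neg_smul, star_neg, neg_neg] at e1 e2
  have e3 : star ((S (star d' * d)).1 v' v) - star ((S (star d * d')).1 v v') =
      (S (star d * d')).1 v v' - (S (star d' * d)).1 v' v := by
    have : Complex.I • (star ((S (star d' * d)).1 v' v) - star ((S (star d * d')).1 v v')) =
      Complex.I • ((S (star d * d')).1 v v' - (S (star d' * d)).1 v' v) := by
      rw [smul_sub, smul_sub, sub_eq_add_neg, sub_eq_add_neg, ← e2, add_comm]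
    exact smul_right_injective A Complex.I_ne_zero this
  have e4 : (2 : ℂ) • star ((S (star d * d')).1 v v') = (2 : ℂ) • (S (star d' * d)).1 v' v := by
    rw [two_smul, two_smul]
    calc _ = (star ((S (star d * d')).1 v v') + star ((S (star d' * d)).1 v' v)) -
        (star ((S (star d' * d)).1 v' v) - star ((S (star d * d')).1 v v')) := by abel
      _ = _ := by rw [e1, e3]; abel
  exact smul_right_injective A (two_ne_zero (α := ℂ)) e4

end CP

/-! ### The kernel of S at elementary tensors, and its domination by the kernel of 1. -/

section Kernel

variable {A V B C H₁ H₂ : Type*} [NonUnitalCStarAlgebra A]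
  [AddCommGroup V] [Module ℂ V] [SMul Aᵐᵒᵖ V] [CStarAlgebra B] [CStarAlgebra C]
  [NormedAddCommGroup H₁] [InnerProductSpace ℂ H₁] [CompleteSpace H₁]
  [NormedAddCommGroup H₂] [InnerProductSpace ℂ H₂] [CompleteSpace H₂]
  {r₁ : WStarRep B H₁} {r₂ : WStarRep C H₂} (S : WTensor r₁ r₂ →ₗ[ℂ] SesqForm A V)

/-- The kernel `((b, v), (b', v')) ↦ S_{b* b' ⊗ c}(v, v')`, linear in `c`. -/
def tensorKernel : C →ₗ[ℂ] (B × V → B × V → A) where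
  toFun c p q := (S (WTensor.tmul r₁ r₂ (star p.1 * q.1) c)).1 p.2 q.2
  map_add' c c' := by
    funext p q
    have h := (S ∘ₗ WTensor.tmulRight r₁ r₂ (star p.1 * q.1)).map_add c c'
    exact congrArg (fun s : SesqForm A V => s.1 p.2 q.2) h
  map_smul' z c := by
    funext p q
    have h := (S ∘ₗ WTensor.tmulRight r₁ r₂ (star p.1 * q.1)).map_smul z c
    exact congrArg (fun s : SesqForm A V => s.1 p.2 q.2) h

theorem tensorKernel_apply (c : C) (p q : B × V) :
    tensorKernel S c p q = (S (WTensor.tmul r₁ r₂ (star p.1 * q.1) c)).1 p.2 q.2 := rfl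

theorem tensorKernel_smul (c : C) (b b' : B) (v v' : V) (z w : ℂ) :
    tensorKernel S c (b, z • v) (b', w • v') = (star z * w) • tensorKernel S c (b, v) (b', v') := by
  simp only [tensorKernel_apply, SesqForm.apply_smul_right, SesqForm.apply_smul_left, smul_smul,
    mul_comm]

variable {S} [PartialOrder A]

/-- Complete positivity of S at the elementary tensors b_i ⊗ c_i, because (b⊗c)*(b'⊗c') = b*b' ⊗
c*c'. -/
theorem IsCP.tensorKernel_sum_nonneg (hS : IsCP S) {ι : Type*} (s : Finset ι) (c : ι → C)
    (p : ι → B × V) :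
    0 ≤ ∑ i ∈ s, ∑ j ∈ s, tensorKernel S (star (c i) * c j) (p i) (p j) := by
  have h := hS.sum_nonneg s (fun i => WTensor.tmul r₁ r₂ (p i).1 (c i)) (fun i => (p i).2)
  simp only [WTensor.star_tmul_mul_tmul] at h
  exact h

theorem IsCP.star_tensorKernel [StarOrderedRing A] (hS : IsCP S) (c c' : C) (p q : B × V) :
    star (tensorKernel S (star c * c') p q) = tensorKernel S (star c' * c) q p := by
  have h := hS.star_apply (WTensor.tmul r₁ r₂ p.1 c) (WTensor.tmul r₁ r₂ q.1 c') p.2 q.2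
  simp only [WTensor.star_tmul_mul_tmul] at h
  exact h

variable [PartialOrder C] [StarOrderedRing C]

theorem IsCP.tensorKernel_nonneg (hS : IsCP S) {ι : Type*} (s : Finset ι) {c : C} (hc : 0 ≤ c)
    (p : ι → B × V) : 0 ≤ ∑ i ∈ s, ∑ j ∈ s, tensorKernel S c (p i) (p j) := by
  obtain ⟨d, rfl⟩ := CStarAlgebra.nonneg_iff_eq_star_mul_self.mp hc
  exact hS.tensorKernel_sum_nonneg s (fun _ => d) p

variable [StarOrderedRing A]

/-- The Radon–Nikodym bound. Both c and ‖c‖1 − c are positive, so the sum for c lies between 0 and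
‖c‖ times the sum for 1; the coefficients z are absorbed into the vectors. -/
theorem IsCP.norm_tensorKernel_le (hS : IsCP S) {ι : Type*} (s : Finset ι) {c : C} (hc : 0 ≤ c)
    (p : ι → B × V) (z : ι → ℂ) :
    ‖∑ i ∈ s, ∑ j ∈ s, (star (z i) * z j) • tensorKernel S c (p i) (p j)‖ ≤
      ‖c‖ * ‖∑ i ∈ s, ∑ j ∈ s, (star (z i) * z j) • tensorKernel S 1 (p i) (p j)‖ := by
  have h : ∀ c : C, ∑ i ∈ s, ∑ j ∈ s, (star (z i) * z j) • tensorKernel S c (p i) (p j) =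
      ∑ i ∈ s, ∑ j ∈ s, tensorKernel S c ((p i).1, z i • (p i).2) ((p j).1, z j • (p j).2) :=
    fun c => by simp only [tensorKernel_smul, Prod.mk.eta]
  have h1 := hS.tensorKernel_nonneg s hc fun i => ((p i).1, z i • (p i).2)
  have h2 := hS.tensorKernel_nonneg s (c := (‖c‖ : ℂ) • 1 - c) (by
    rw [sub_nonneg]
    have := IsSelfAdjoint.le_algebraMap_norm_self (IsSelfAdjoint.of_nonneg hc)
    rw [Algebra.algebraMap_eq_smul_one] at this
    simpa using this) fun i => ((p i).1, z i • (p i).2)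
  rw [← h] at h1 h2
  have h3 : ∑ i ∈ s, ∑ j ∈ s, (star (z i) * z j) • tensorKernel S ((‖c‖ : ℂ) • 1 - c) (p i) (p j) =
      (‖c‖ : ℂ) • (∑ i ∈ s, ∑ j ∈ s, (star (z i) * z j) • tensorKernel S 1 (p i) (p j)) -
      ∑ i ∈ s, ∑ j ∈ s, (star (z i) * z j) • tensorKernel S c (p i) (p j) := by
    simp only [map_sub, map_smul, Pi.sub_apply, Pi.smul_apply, smul_sub, Finset.sum_sub_distrib,
      Finset.smul_sum, smul_smul, mul_comm]
  rw [h3, sub_nonneg] at h2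
  refine (CStarAlgebra.norm_le_norm_of_nonneg_of_le h1 h2).trans ?_
  rw [norm_smul]
  simp

omit [PartialOrder A] [StarOrderedRing A] in
/-- A linear map on a C*-algebra lifts through an injective linear map as soon as it does so on
the positive elements. -/
theorem exists_linear_lift {Y Z : Type*} [AddCommGroup Y] [Module ℂ Y] [AddCommGroup Z]
    [Module ℂ Z] (i : Y →ₗ[ℂ] Z) (hi : Function.Injective i) (κ : C →ₗ[ℂ] Z)
    (h : ∀ c : C, 0 ≤ c → ∃ y, i y = κ c) : ∃ f : C →ₗ[ℂ] Y, ∀ c, i (f c) = κ c := by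
  have hr : ∀ c, κ c ∈ LinearMap.range i := by
    have : (⊤ : Submodule ℂ C) ≤ (LinearMap.range i).comap κ := by
      rw [← CStarAlgebra.span_nonneg, Submodule.span_le]
      exact fun c hc => h c hc
    exact fun c => this trivial
  refine ⟨(LinearEquiv.ofInjective i hi).symm.toLinearMap ∘ₗ κ.codRestrict _ hr, fun c => ?_⟩
  exact congrArg Subtype.val ((LinearEquiv.ofInjective i hi).apply_symm_apply ⟨κ c, hr c⟩)

end Kernel

/-! ### Operators determined by their matrix elements on the dilation vectors -/

section Dilation

variable {A V B C G H₁ H₂ M : Type*} [NonUnitalCStarAlgebra A] [PartialOrder A]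
  [AddCommGroup V] [Module ℂ V] [CStarAlgebra B] [CStarAlgebra C]
  [NormedAddCommGroup H₁] [InnerProductSpace ℂ H₁] [CompleteSpace H₁]
  [NormedAddCommGroup H₂] [InnerProductSpace ℂ H₂] [CompleteSpace H₂]
  {r₁ : WStarRep B H₁} {r₂ : WStarRep C H₂}
  [NormedAddCommGroup M] [NormedSpace ℂ M] [SMul Aᵐᵒᵖ M] [HilbertModule A M]

/-- The vectors `π(b)Kv`. -/
def dilationVec (π : B →⋆ₐ[ℂ] AdjOp A M) (K : V →ₗ[ℂ] M) (p : B × V) : M := (π p.1).1 (K p.2)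

theorem dilationSpan_eq (π : B →⋆ₐ[ℂ] AdjOp A M) (K : V →ₗ[ℂ] M) :
    dilationSpan π K = (Submodule.span ℂ (Set.range (dilationVec π K)) : Set M) := by
  have : {m : M | ∃ (b : B) (v : V), m = (π b).1 (K v)} = Set.range (dilationVec π K) := by
    ext m
    simp only [Set.mem_ofPred_eq, Set.mem_range, Prod.exists, dilationVec, eq_comm]
  rw [dilationSpan, this]

theorem dilationVec_smul (π : B →⋆ₐ[ℂ] AdjOp A M) (K : V →ₗ[ℂ] M) (z : ℂ) (p : B × V) :
    z • dilationVec π K p = dilationVec π K (p.1, z • p.2) := by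
  simp only [dilationVec, map_smul]

theorem dilationVec_mul (π : B →⋆ₐ[ℂ] AdjOp A M) (K : V →ₗ[ℂ] M) (b b' : B) (v : V) :
    (π b).1 (dilationVec π K (b', v)) = dilationVec π K (b * b', v) := by
  simp only [dilationVec, map_mul]; rfl

theorem dilationVec_one (π : B →⋆ₐ[ℂ] AdjOp A M) (K : V →ₗ[ℂ] M) (v : V) :
    dilationVec π K (1, v) = K v := by
  simp only [dilationVec, map_one]; rfl

theorem inner_map_dilation (π : B →⋆ₐ[ℂ] AdjOp A M) (b : B) (m n : M) :
    inner A m ((π b).1 n) = inner A ((π (star b)).1 m) n := by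
  rw [inner_adjOp, map_star]

/-- The vectors `π(b)Kv` have trivial orthogonal complement. -/
def IsSeparating (π : B →⋆ₐ[ℂ] AdjOp A M) (K : V →ₗ[ℂ] M) : Prop :=
  ∀ m : M, (∀ p, inner A (dilationVec π K p) m = 0) → m = 0

variable {π : B →⋆ₐ[ℂ] AdjOp A M} {K : V →ₗ[ℂ] M}

/-- Separation first gives equality on the dilation vectors only, and these need not be total in
norm. Doing the same for the adjoints and moving them across the inner product reaches every m. -/
theorem IsSeparating.adjOp_ext (hD : IsSeparating π K) {E E' : AdjOp A M}
    (h : ∀ p q, inner A (dilationVec π K p) (E.1 (dilationVec π K q)) =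
      inner A (dilationVec π K p) (E'.1 (dilationVec π K q))) : E = E' := by
  have key : ∀ {F F' : AdjOp A M}, (∀ p q, inner A (dilationVec π K p) (F.1 (dilationVec π K q)) =
      inner A (dilationVec π K p) (F'.1 (dilationVec π K q))) →
      ∀ q, F.1 (dilationVec π K q) = F'.1 (dilationVec π K q) := fun {F F'} h q => by
    rw [← sub_eq_zero]
    refine hD _ fun p => ?_
    rw [inner_sub_right_hilbertModule, h, sub_self]
  have h' := key (F := star E) (F' := star E') fun p q => by
    rw [inner_star_adjOp, inner_star_adjOp, key h p]
  refine Subtype.ext (ContinuousLinearMap.ext fun m => ?_)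
  rw [← sub_eq_zero]
  refine hD _ fun p => ?_
  rw [inner_sub_right_hilbertModule, inner_adjOp, inner_adjOp, h', sub_self]

variable [SMul Aᵐᵒᵖ V] {S : WTensor r₁ r₂ →ₗ[ℂ] SesqForm A V}

/-- `E` has the matrix elements `⟨π(b)Kv, E(c)π(b')Kv'⟩ = S_{b* b' ⊗ c}(v, v')`. -/
def HasKernel (S : WTensor r₁ r₂ →ₗ[ℂ] SesqForm A V) (π : B →⋆ₐ[ℂ] AdjOp A M) (K : V →ₗ[ℂ] M)
    (E : C →ₗ[ℂ] AdjOp A M) : Prop :=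
  ∀ c p q, inner A (dilationVec π K p) ((E c).1 (dilationVec π K q)) = tensorKernel S c p q

-- Operators found separately for each c ≥ 0 fit into a linear map because an operator is determined
-- by its matrix elements, which are linear in c.
variable [PartialOrder C] [StarOrderedRing C] in
theorem IsSeparating.exists_hasKernel (hD : IsSeparating π K)
    (h : ∀ c : C, 0 ≤ c → ∃ T : AdjOp A M, ∀ p q,
      inner A (dilationVec π K p) (T.1 (dilationVec π K q)) = tensorKernel S c p q) :
    ∃ E : C →ₗ[ℂ] AdjOp A M, HasKernel S π K E := by
  let i : AdjOp A M →ₗ[ℂ] (B × V → B × V → A) :=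
    { toFun := fun T p q => inner A (dilationVec π K p) (T.1 (dilationVec π K q))
      map_add' := fun T T' => by
        funext p q; exact HilbertModule.inner_add_right _ _ _
      map_smul' := fun z T => by
        funext p q; exact HilbertModule.inner_smul_right _ _ _ }
  obtain ⟨E, hE⟩ := exists_linear_lift i
    (fun T T' h => hD.adjOp_ext fun p q => congrFun (congrFun h p) q) (tensorKernel S)
    fun c hc => (h c hc).imp fun T hT => funext fun p => funext fun q => hT p q
  exact ⟨E, fun c p q => congrFun (congrFun (hE c) p) q⟩

variable [Group G] {β : G →* (B ≃⋆ₐ[ℂ] B)} {γ : G →* (C ≃⋆ₐ[ℂ] C)}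
  {δ : G →* (WTensor r₁ r₂ ≃⋆ₐ[ℂ] WTensor r₁ r₂)} {U : G →* (V ≃ₗ[ℂ] V)}
  {Ut : G →* unitary (AdjOp A M)}

/-- The adjoint π(b)* crosses the inner product and E(c) commutes with π(b'), so the form identity
at b*b' applies. Uniqueness rests on this. -/
theorem IsSubminimal.hasKernel {E : C →ₗ[ℂ] AdjOp A M} (hE : IsSubminimal S γ π K Ut E) :
    HasKernel S π K E := fun c p q => by
  rw [tensorKernel_apply, hE.form, map_mul, map_star, mul_assoc, hE.commute]
  change _ = inner A (K p.2) ((star (π p.1)).1 ((E c).1 ((π q.1).1 (K q.2))))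
  rw [inner_star_adjOp]
  rfl

theorem IsSeparating.subminimal_unique (hD : IsSeparating π K) {E E' : C →ₗ[ℂ] AdjOp A M}
    (hE : HasKernel S π K E) (hE' : IsSubminimal S γ π K Ut E') : E' = E :=
  LinearMap.ext fun c => hD.adjOp_ext fun p q => by rw [hE, hE'.hasKernel]

theorem IsCovariantDilation.tensorKernel_one
    (hdil : IsCovariantDilation (marginalOne S) β U π K Ut) (p q : B × V) :
    tensorKernel S 1 p q = inner A (dilationVec π K p) (dilationVec π K q) := by
  have h := hdil.form (star p.1 * q.1) p.2 q.2
  refine Eq.trans h ?_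
  rw [map_mul, map_star]
  change inner A (K p.2) ((star (π p.1)).1 ((π q.1).1 (K q.2))) = _
  rw [inner_star_adjOp]
  rfl

theorem IsSeparating.map_one (hD : IsSeparating π K)
    (hdil : IsCovariantDilation (marginalOne S) β U π K Ut) {E : C →ₗ[ℂ] AdjOp A M}
    (hE : HasKernel S π K E) : E 1 = 1 :=
  hD.adjOp_ext fun p q => by
    rw [hE, hdil.tensorKernel_one]; rfl

theorem IsCovariantDilation.apply_dilationVec
    (hdil : IsCovariantDilation (marginalOne S) β U π K Ut) (g : G) (p : B × V) :
    (Ut g).1.1 (dilationVec π K p) = dilationVec π K (β g p.1, U g p.2) := by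
  have h := congrArg (fun T : AdjOp A M => T.1 (K p.2)) (hdil.covariant g p.1)
  refine Eq.trans h ?_
  change (π (β g p.1)).1 ((Ut g).1.1 (K p.2)) = _
  rw [← hdil.intertwine]
  rfl

/-- The operator identities are tested on matrix elements. Covariance becomes covariance of S, and
commutation becomes (b*b₁)*b₂ = b₁*(bb₂). Complete positivity is an input, since its proof depends
on the kind of density. -/
theorem HasKernel.isSubminimal (hD : IsSeparating π K)
    (hdil : IsCovariantDilation (marginalOne S) β U π K Ut) (hδ : IsTensorAction β γ δ)
    (hSU : IsCovariant δ U S) {E : C →ₗ[ℂ] AdjOp A M} (hE : HasKernel S π K E)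
    (hcp : IsCPOp E) : IsSubminimal S γ π K Ut E where
  cp := hcp
  covariant g c := hD.adjOp_ext fun p q => by
    change inner A _ ((Ut g).1.1 ((E c).1 _)) = inner A _ ((E (γ g c)).1 ((Ut g).1.1 _))
    have hst : star (Ut g).1 = (Ut g⁻¹).1 := by rw [map_inv]; rfl
    rw [inner_adjOp, hst, hdil.apply_dilationVec, hdil.apply_dilationVec, hE, hE,
      tensorKernel_apply, tensorKernel_apply]
    -- The arguments are chosen so that β_g undoes β_{g⁻¹} on p and U(g⁻¹) undoes U(g) on q.
    have h := hSU g (WTensor.tmul r₁ r₂ (star (β g⁻¹ p.1) * q.1) c) p.2 (U g q.2)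
    rw [hδ] at h
    have h1 : β g (β g⁻¹ p.1) = p.1 := by
      rw [← StarAlgEquiv.mul_apply, ← map_mul, mul_inv_cancel, _root_.map_one]; rfl
    have h2 : U g⁻¹ (U g q.2) = q.2 := by
      rw [← LinearEquiv.mul_apply, ← map_mul, inv_mul_cancel, _root_.map_one]; rfl
    rw [map_mul, map_star, h1, h2] at h
    exact h.symm
  commute b c := hD.adjOp_ext fun p q => by
    change inner A _ ((π b).1 ((E c).1 _)) = inner A _ ((E c).1 ((π b).1 _))
    rw [inner_map_dilation, dilationVec_mul, dilationVec_mul, hE, hE, tensorKernel_apply,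
      tensorKernel_apply]
    simp only [star_mul, star_star, mul_assoc]
  form b c v w := by
    change _ = inner A (K v) ((π b).1 ((E c).1 (K w)))
    rw [inner_map_dilation, ← dilationVec_one π K v, dilationVec_mul, ← dilationVec_one π K w, hE,
      tensorKernel_apply]
    simp

end Dilation

/-! ### Norm dense dilations -/

section NormDense

variable {A V B C G H₁ H₂ M : Type*} [NonUnitalCStarAlgebra A] [PartialOrder A]
  [AddCommGroup V] [Module ℂ V] [CStarAlgebra B] [CStarAlgebra C]
  [NormedAddCommGroup H₁] [InnerProductSpace ℂ H₁] [CompleteSpace H₁]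
  [NormedAddCommGroup H₂] [InnerProductSpace ℂ H₂] [CompleteSpace H₂]
  {r₁ : WStarRep B H₁} {r₂ : WStarRep C H₂}
  [NormedAddCommGroup M] [NormedSpace ℂ M] [SMul Aᵐᵒᵖ M] [HilbertModule A M]
  {π : B →⋆ₐ[ℂ] AdjOp A M} {K : V →ₗ[ℂ] M}

theorem isSeparating_of_dense
    (hd : Dense (Submodule.span ℂ (Set.range (dilationVec π K)) : Set M)) :
    IsSeparating π K := by
  intro m hm
  have h : ∀ y : M, inner A y m = 0 := by
    have hcl : IsClosed {y : M | inner A y m = 0} :=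
      isClosed_eq (continuous_inner_hilbertModule.comp (f := fun y : M => (y, m)) (by fun_prop))
        continuous_const
    refine fun y => (hcl.closure_subset_iff.mpr ?_) (hd y)
    intro y hy
    induction hy using Submodule.span_induction with
    | mem x h => obtain ⟨p, rfl⟩ := h; exact hm p
    | zero => exact (by simpa using HilbertModule.inner_smul_left (A := A) (0 : ℂ) (0 : M) m)
    | add x y _ _ hx hy =>
      change inner A (x + y) m = 0
      rw [HilbertModule.inner_add_left, show inner A x m = 0 from hx,
        show inner A y m = 0 from hy, add_zero]
    | smul z x _ hx =>
      change inner A (z • x) m = 0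
      rw [HilbertModule.inner_smul_left, show inner A x m = 0 from hx, smul_zero]
  exact HilbertModule.inner_self_eq_zero m (h m)

/-- ‖ma‖² = ‖a*⟨m,m⟩a‖ ≤ ‖a‖²‖m‖². Continuity of the action is not among the module axioms. -/
theorem continuous_act (a : A) : Continuous fun m : M => m <• a := by
  let f : M →+ M := ⟨⟨fun m => m <• a, by
    refine HilbertModule.ext_inner (A := A) fun k => ?_
    rw [HilbertModule.inner_act_right, inner_zero_right_hilbertModule, zero_mul]⟩,
    fun m n => RightModule.add_act m n a⟩
  refine AddMonoidHomClass.continuous_of_bound f ‖a‖ fun m => ?_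
  change ‖m <• a‖ ≤ _
  rw [← abs_of_nonneg (norm_nonneg (m <• a)),
    ← abs_of_nonneg (mul_nonneg (norm_nonneg a) (norm_nonneg m)), ← sq_le_sq,
    HilbertModule.norm_sq (A := A), HilbertModule.inner_act_left, HilbertModule.inner_act_right,
    mul_pow, HilbertModule.norm_sq (A := A) m]
  refine (norm_mul_le _ _).trans ?_
  rw [norm_star, sq, mul_assoc]
  gcongr
  rw [mul_comm]
  exact norm_mul_le _ _

variable [SMul Aᵐᵒᵖ V] {S : WTensor r₁ r₂ →ₗ[ℂ] SesqForm A V} [Group G]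
  {β : G →* (B ≃⋆ₐ[ℂ] B)} {U : G →* (V ≃ₗ[ℂ] V)} {Ut : G →* unitary (AdjOp A M)}

theorem IsCovariantDilation.norm_sum_smul_sq
    (hdil : IsCovariantDilation (marginalOne S) β U π K Ut) {ι : Type*} (s : Finset ι)
    (p : ι → B × V) (z : ι → ℂ) :
    ∑ i ∈ s, ∑ j ∈ s, (star (z i) * z j) • tensorKernel S 1 (p i) (p j) =
      inner A (∑ i ∈ s, z i • dilationVec π K (p i)) (∑ i ∈ s, z i • dilationVec π K (p i)) := by
  have h : ∀ m n : M, inner A m n = innerSesq A M m n := fun _ _ => rfl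
  rw [h]
  simp only [map_sum, LinearMap.sum_apply, map_smulₛₗ, LinearMap.smul_apply, ← h,
    hdil.tensorKernel_one, RingHom.id_apply, Finset.smul_sum, smul_smul]
  rw [Finset.sum_comm]
  simp only [mul_comm]
  rfl

theorem IsCovariantDilation.dilationVec_act
    (hdil : IsCovariantDilation (marginalOne S) β U π K Ut) (p : B × V) (a : A) :
    dilationVec π K p <• a = dilationVec π K (p.1, p.2 <• a) := by
  change (π p.1).1 (K p.2) <• a = (π p.1).1 (K (p.2 <• a))
  rw [hdil.linear]
  exact ((π p.1).2.1 _ a).symm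

variable [PartialOrder C] [StarOrderedRing C] [StarOrderedRing A]

/-- The dominated kernel extends to a bounded form t. Its A-linearity is clear on the vectors
π(b)Kv, where the action only changes v, and spreads by continuity to M; self-duality then
represents t. -/
theorem exists_adjOp_of_dense (hM : IsSelfDual A M)
    (hd : Dense (Submodule.span ℂ (Set.range (dilationVec π K)) : Set M))
    (hdil : IsCovariantDilation (marginalOne S) β U π K Ut) (hS : IsCP S) {c : C} (hc : 0 ≤ c) :
    ∃ T : AdjOp A M, ∀ p q,
      inner A (dilationVec π K p) (T.1 (dilationVec π K q)) = tensorKernel S c p q := by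
  obtain ⟨t, ht⟩ := exists_sesq_extension (dilationVec π K) hd (tensorKernel S c)
    (norm_nonneg c) (fun s z => by
      refine (hS.norm_tensorKernel_le s hc id z).trans_eq ?_
      rw [hdil.norm_sum_smul_sq s id z, HilbertModule.norm_sq (A := A)]
      rfl)
  have hcl : ∀ {P : M → Prop}, IsClosed {m | P m} → (∀ p, P (dilationVec π K p)) →
      (∀ x y, P x → P y → P (x + y)) → (∀ (z : ℂ) x, P x → P (z • x)) → P 0 → ∀ m, P m := by
    intro P h1 h2 h3 h4 h5 m
    refine (h1.closure_subset_iff.mpr ?_) (hd m)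
    intro y hy
    induction hy using Submodule.span_induction with
    | mem x h => obtain ⟨p, rfl⟩ := h; exact h2 p
    | zero => exact h5
    | add x y _ _ hx hy => exact h3 x y hx hy
    | smul z x _ hx => exact h4 z x hx
  have hz : ∀ a : A, (0 : M) <• a = 0 := fun a => by
    refine HilbertModule.ext_inner (A := A) fun k => ?_
    rw [HilbertModule.inner_act_right, inner_zero_right_hilbertModule, zero_mul]
  have hr : ∀ m n a, t m (n <• a) = t m n * a := fun m n a => by
    have hca := continuous_act (A := A) (M := M) a
    revert n
    refine hcl (isClosed_eq (by fun_prop) (by fun_prop)) (fun q => ?_) (fun x y hx hy => ?_)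
      (fun z x hx => ?_) ?_
    · revert m
      refine hcl (isClosed_eq (by fun_prop) (by fun_prop)) (fun p => ?_) (fun x y hx hy => ?_)
        (fun z x hx => ?_) ?_
      · rw [hdil.dilationVec_act, ht, ht, tensorKernel_apply, tensorKernel_apply,
          SesqForm.apply_act_right]
      · simp [hx, hy, add_mul]
      · simp [hx, smul_mul_assoc]
      · simp
    · rw [RightModule.add_act, map_add, map_add, hx, hy, add_mul]
    · rw [RightModule.smul_act, (t m).map_smul, (t m).map_smul, hx, smul_mul_assoc]
    · rw [hz]; simp
  have hl : ∀ n m a, t (m <• a) n = star a * t m n := fun n m a => by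
    have hca := continuous_act (A := A) (M := M) a
    revert m
    refine hcl (isClosed_eq (by fun_prop) (by fun_prop)) (fun q => ?_) (fun x y hx hy => ?_)
      (fun z x hx => ?_) ?_
    · revert n
      refine hcl (isClosed_eq (by fun_prop) (by fun_prop)) (fun p => ?_) (fun x y hx hy => ?_)
        (fun z x hx => ?_) ?_
      · rw [hdil.dilationVec_act, ht, ht, tensorKernel_apply, tensorKernel_apply,
          SesqForm.apply_act_left]
      · simp [hx, hy, mul_add]
      · simp [hx, mul_smul_comm]
      · simp
    · rw [RightModule.add_act, map_add, map_add, add_apply, add_apply, hx, hy, mul_add]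
    · rw [RightModule.smul_act, map_smulₛₗ t z, map_smulₛₗ t z, smul_apply, smul_apply, hx, mul_smul_comm]
    · rw [hz]; simp
  obtain ⟨T, hT⟩ := exists_adjOp_of_sesqForm hM ⟨fun m n => t m n,
    fun u v w z => by simp, fun u v w z => by simp, fun u v a => hr u v a,
    fun u v a => hl v u a⟩ (C := ‖t‖) (fun m n => t.le_opNorm₂ m n)
  exact ⟨T, fun p q => (hT _ _).trans (ht p q)⟩

omit [PartialOrder C] [StarOrderedRing C] in
theorem HasKernel.isCPOp_of_dense
    (hd : Dense (Submodule.span ℂ (Set.range (dilationVec π K)) : Set M)) (hS : IsCP S)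
    {E : C →ₗ[ℂ] AdjOp A M} (hE : HasKernel S π K E) : IsCPOp E := by
  intro n c m
  refine sum_sesq_nonneg_of_dense
    (fun j k => (innerSesq A M).compl₂ (E (star (c j) * c k)).1.toLinearMap) (fun j k => ?_)
    (dilationVec π K) hd (fun s z => ?_) m
  · exact continuous_inner_hilbertModule.comp
      (f := fun p : M × M => (p.1, (E (star (c j) * c k)).1 p.2)) (by fun_prop)
  · refine (hS.tensorKernel_sum_nonneg s (fun p => c p.1)
      (fun p => (p.2.1, z p • p.2.2))).trans_eq ?_
    refine Finset.sum_congr rfl fun p _ => Finset.sum_congr rfl fun r _ => ?_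
    rw [← hE, dilationVec_smul, dilationVec_smul]
    rfl

end NormDense

/-! ### Positive matrices over a C*-algebra -/

section Matrix

variable {A : Type*} [NonUnitalCStarAlgebra A] [PartialOrder A] [StarOrderedRing A]

/-- A selfadjoint element `a` is nonnegative as soon as `q a q` is, where `q = w* w` is its negative
part; this is formulated without mentioning the negative part. -/
theorem exists_negPart_witness {a : A} (ha : IsSelfAdjoint a) :
    ∃ q w : A, star q = q ∧ star (w * q) * (w * q) = -(q * a * q) ∧
      (w * q = 0 → ∃ x, a = star x * x) := by
  have hs : star a⁻ = a⁻ := (CFC.negPart_nonneg a).isSelfAdjoint.star_eq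
  obtain ⟨w, hw⟩ := CStarAlgebra.nonneg_iff_eq_star_mul_self.mp (CFC.negPart_nonneg a)
  have hd := CFC.posPart_sub_negPart a ha
  -- With q = a⁻ = w*w this gives −qaq = q³ = (wq)*(wq); and wq = 0 forces q² = w*(wq)q-free, that
  -- is q² = w*(wq) = 0, so a is its positive part.
  have h1 : a⁻ * a = -(a⁻ * a⁻) := by
    rw [← sub_eq_zero, sub_neg_eq_add, ← mul_add]
    nth_rewrite 2 [← hd]
    rw [sub_add_cancel, CFC.negPart_mul_posPart]
  refine ⟨a⁻, w, hs, ?_, fun h => ?_⟩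
  · rw [h1, neg_mul, neg_neg, star_mul, hs, mul_assoc, ← mul_assoc (star w), ← hw, mul_assoc]
  · have h2 : star a⁻ * a⁻ = 0 := by
      rw [hs]
      conv_lhs => rw [hw, mul_assoc, ← hw, h, mul_zero]
    have h3 : a⁻ = 0 := CStarRing.star_mul_self_eq_zero_iff _ |>.mp h2
    rw [h3, sub_zero] at hd
    exact CStarAlgebra.nonneg_iff_eq_star_mul_self.mp (hd ▸ CFC.posPart_nonneg a)

/-- A hermitian matrix `N` over a C*-algebra with `∑ aᵢ* Nᵢⱼ aⱼ ≥ 0` is of the form `R* R`. -/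
theorem exists_gram_factorization {ι : Type*} [Fintype ι] (N : ι → ι → A)
    (hN : ∀ i j, star (N i j) = N j i)
    (h : ∀ a : ι → A, 0 ≤ ∑ i, ∑ j, star (a i) * N i j * a j) :
    ∃ R : ι → ι → A, ∀ i j, N i j = ∑ k, star (R k i) * R k j := by
  let P : CStarMatrix ι ι A := CStarMatrix.ofMatrix N
  have hP : IsSelfAdjoint P := by
    refine CStarMatrix.ext fun i j => ?_
    exact hN j i
  have hdiag : ∀ (X : CStarMatrix ι ι A) (i : ι), 0 ≤ (star X * X) i i := fun X i => by
    rw [CStarMatrix.mul_apply]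
    exact Finset.sum_nonneg fun k _ => star_mul_self_nonneg _
  -- The diagonal entries of (WQ)*(WQ) = −QPQ are sums of squares, and they are nonpositive by the
  -- hypothesis at the columns of Q. Hence every entry of WQ vanishes.
  obtain ⟨Q, W, hQs, h3, h7⟩ := exists_negPart_witness hP
  have hQ : ∀ i, 0 ≤ (Q * P * Q) i i := fun i => by
    refine (h fun k => Q k i).trans_eq ?_
    rw [CStarMatrix.mul_apply, Finset.sum_comm]
    refine Finset.sum_congr rfl fun k _ => ?_
    rw [CStarMatrix.mul_apply, Finset.sum_mul]
    refine Finset.sum_congr rfl fun l _ => ?_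
    have : star (Q l i) = Q i l := by
      conv_rhs => rw [← hQs]
      rfl
    rw [this]
    rfl
  have h4 : W * Q = 0 := by
    refine CStarMatrix.ext fun k i => ?_
    have h5 : (star (W * Q) * (W * Q)) i i = 0 := by
      refine le_antisymm ?_ (hdiag _ i)
      rw [h3]
      exact neg_nonpos.mpr (hQ i)
    rw [CStarMatrix.mul_apply] at h5
    have h6 := (Finset.sum_eq_zero_iff_of_nonneg fun k _ => by
      exact star_mul_self_nonneg ((W * Q) k i)).mp h5 k (Finset.mem_univ _)
    exact CStarRing.star_mul_self_eq_zero_iff _ |>.mp h6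
  obtain ⟨R, hR⟩ := h7 h4
  refine ⟨fun k i => R k i, fun i j => ?_⟩
  change P i j = _
  rw [hR, CStarMatrix.mul_apply]
  rfl

end Matrix

/-! ### Operators on Hilbert spaces -/

section Hilbert

variable {X : Type*} [NormedAddCommGroup X] [InnerProductSpace ℂ X] [CompleteSpace X]

omit [CompleteSpace X] in
theorem clm_nonneg_iff {T : X →L[ℂ] X} : 0 ≤ T ↔ ∀ x, 0 ≤ ⟪x, T x⟫_ℂ := by
  rw [ContinuousLinearMap.nonneg_iff_isPositive]
  constructor
  · exact fun h x => h.inner_nonneg_right x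
  · intro h
    rw [ContinuousLinearMap.isPositive_iff_complex]
    intro x
    have h1 := h x
    have h2 : ⟪T x, x⟫_ℂ = ⟪x, T x⟫_ℂ := by
      rw [← inner_conj_symm, RCLike.conj_eq_iff_im.mpr]
      exact (RCLike.nonneg_iff.mp h1).2
    rw [h2]
    exact ⟨RCLike.ext (by simp) (by simpa using (RCLike.nonneg_iff.mp h1).2.symm),
      (RCLike.nonneg_iff.mp h1).1⟩

/-- A positive operator annihilates the vectors on which its quadratic form vanishes. -/
theorem clm_apply_eq_zero_of_nonneg {T : X →L[ℂ] X} (hT : 0 ≤ T) {x : X}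
    (hx : ⟪x, T x⟫_ℂ = 0) : T x = 0 := by
  obtain ⟨W, rfl⟩ := CStarAlgebra.nonneg_iff_eq_star_mul_self.mp hT
  change ⟪x, (star W) (W x)⟫_ℂ = 0 at hx
  rw [ContinuousLinearMap.star_eq_adjoint, ContinuousLinearMap.adjoint_inner_right,
    inner_self_eq_zero] at hx
  change (star W) (W x) = 0
  rw [hx, map_zero]

/-- Bounded families of operators converge weakly along ultrafilters. -/
theorem exists_weak_limit {ι : Type*} (𝓤 : Ultrafilter ι) (T : ι → X →L[ℂ] X) {C : ℝ}
    (hT : ∀ᶠ i in 𝓤, ‖T i‖ ≤ C) :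
    ∃ T₀ : X →L[ℂ] X, ∀ x y, Tendsto (fun i => ⟪x, T i y⟫_ℂ) 𝓤 (𝓝 ⟪x, T₀ y⟫_ℂ) := by
  have hb : ∀ x y, ∀ᶠ i in 𝓤, ⟪T i x, y⟫_ℂ ∈ Metric.closedBall (0 : ℂ) (C * ‖x‖ * ‖y‖) := by
    intro x y
    filter_upwards [hT] with i hi
    rw [mem_closedBall_zero_iff]
    refine (norm_inner_le_norm _ _).trans ?_
    gcongr
    exact (T i).le_of_opNorm_le hi x
  -- Compactness of the ball gives a limit for each pair x, y; uniqueness of limits makes the limits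
  -- sesquilinear in the pair.
  have hl : ∀ x y, ∃ l ∈ Metric.closedBall (0 : ℂ) (C * ‖x‖ * ‖y‖),
      Tendsto (fun i => ⟪T i x, y⟫_ℂ) 𝓤 (𝓝 l) := fun x y => by
    obtain ⟨l, hl, hle⟩ := (isCompact_closedBall (0 : ℂ) (C * ‖x‖ * ‖y‖)).ultrafilter_le_nhds
      (𝓤.map fun i => ⟪T i x, y⟫_ℂ) (by
        rw [Ultrafilter.coe_map, Filter.le_principal_iff]; exact hb x y)
    exact ⟨l, hl, hle⟩
  choose l hlb hl using hl
  let b : X →ₗ⋆[ℂ] X →ₗ[ℂ] ℂ := LinearMap.mk₂'ₛₗ (starRingEnd ℂ) (RingHom.id ℂ) l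
    (fun x x' y => tendsto_nhds_unique (hl _ _) (((hl x y).add (hl x' y)).congr fun i => by
      rw [map_add, inner_add_left]))
    (fun z x y => tendsto_nhds_unique (hl _ _) (((hl x y).const_smul _).congr fun i => by
      rw [map_smul, inner_smul_left]; rfl))
    (fun x y y' => tendsto_nhds_unique (hl _ _) (((hl x y).add (hl x y')).congr fun i => by
      rw [inner_add_right]))
    (fun z x y => tendsto_nhds_unique (hl _ _) (((hl x y).const_smul _).congr fun i => by
      rw [inner_smul_right]; rfl))
  let B := LinearMap.mkContinuous₂ b C fun x y => mem_closedBall_zero_iff.mp (hlb x y)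
  refine ⟨InnerProductSpace.continuousLinearMapOfBilin B, fun x y => ?_⟩
  have h : ⟪x, InnerProductSpace.continuousLinearMapOfBilin B y⟫_ℂ = (starRingEnd ℂ) (l y x) := by
    rw [← inner_conj_symm, InnerProductSpace.continuousLinearMapOfBilin_apply]
    rfl
  rw [h]
  refine ((continuous_star.tendsto _).comp (hl y x)).congr fun i => ?_
  exact inner_conj_symm _ _

/-- An ultrafilter on a directed set that contains all its upper sections. -/
theorem exists_ultrafilter_directedOn {α : Type*} [Preorder α] {s : Set α} (hs : s.Nonempty)
    (hd : DirectedOn (· ≤ ·) s) :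
    ∃ 𝓤 : Ultrafilter α, (∀ᶠ a in 𝓤, a ∈ s) ∧ ∀ a₀ ∈ s, ∀ᶠ a in 𝓤, a₀ ≤ a := by
  have := hs.to_subtype
  have := hd.isDirectedOrder
  refine ⟨(Ultrafilter.of (atTop : Filter s)).map Subtype.val, ?_, fun a₀ ha₀ => ?_⟩
  · exact Filter.Eventually.of_forall (f := ((Ultrafilter.of (atTop : Filter s)) : Filter s))
      fun a => a.2
  · have : ∀ᶠ a : s in atTop, a₀ ≤ a := eventually_ge_atTop (⟨a₀, ha₀⟩ : s)
    exact Ultrafilter.of_le _ this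

end Hilbert

/-! ### Representations of W*-algebras -/

section Rep

variable {A HA : Type*} [NonUnitalCStarAlgebra A]
  [NormedAddCommGroup HA] [InnerProductSpace ℂ HA] [CompleteSpace HA] (r : WStarRep A HA)

/-- The representation of `A` by bounded operators. -/
def WStarRep.rep : A →⋆ₙₐ[ℂ] (HA →L[ℂ] HA) where
  toFun a := (r.iso a).1
  map_smul' z a := by rw [map_smul]; rfl
  map_zero' := by rw [map_zero]; rfl
  map_add' a a' := by rw [map_add]; rfl
  map_mul' a a' := by rw [map_mul]; rfl
  map_star' a := by rw [map_star]; rfl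

theorem WStarRep.rep_injective : Function.Injective r.rep := fun _ _ h =>
  r.iso.injective (Subtype.ext h)

theorem WStarRep.norm_rep (a : A) : ‖r.rep a‖ = ‖a‖ :=
  NonUnitalStarAlgHom.norm_map r.rep r.rep_injective a

/-- An operator that commutes with the commutant of `A` belongs to `A`. -/
theorem WStarRep.exists_rep_eq {T : HA →L[ℂ] HA}
    (h : ∀ u : HA →L[ℂ] HA, (∀ a, u * r.rep a = r.rep a * u) → u * T = T * u) :
    ∃ a, r.rep a = T := by
  have hT : T ∈ r.alg := by
    rw [← SetLike.mem_coe, ← r.alg.centralizer_centralizer, Set.mem_centralizer_iff]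
    refine fun u hu => h u fun a => ?_
    rw [Set.mem_centralizer_iff] at hu
    exact (hu _ (r.iso a).2).symm
  obtain ⟨a, ha⟩ := r.iso.surjective ⟨T, hT⟩
  exact ⟨a, congrArg Subtype.val ha⟩

variable [PartialOrder A] [StarOrderedRing A]

/-- For the nontrivial direction, the image of (wq)*(wq) = −qaq is both nonnegative and nonpositive,
so wq = 0 by injectivity and a is a square. -/
theorem WStarRep.rep_nonneg_iff {a : A} : 0 ≤ r.rep a ↔ 0 ≤ a := by
  constructor
  · intro h
    have ha : IsSelfAdjoint a := r.rep_injective (by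
      rw [map_star]; exact (IsSelfAdjoint.of_nonneg h).star_eq)
    obtain ⟨q, w, hq, h3, h4⟩ := exists_negPart_witness ha
    have h1 : 0 ≤ star (r.rep q) * r.rep a * r.rep q := star_left_conjugate_nonneg h _
    rw [← map_star, hq, ← map_mul, ← map_mul, ← neg_neg (q * a * q), ← h3, map_neg, neg_nonneg,
      map_mul, map_star] at h1
    have h5 : r.rep (w * q) = 0 :=
      CStarRing.star_mul_self_eq_zero_iff _ |>.mp (le_antisymm h1 (star_mul_self_nonneg _))
    exact CStarAlgebra.nonneg_iff_eq_star_mul_self.mpr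
      (h4 (r.rep_injective (h5.trans (map_zero _).symm)))
  · intro h
    obtain ⟨w, rfl⟩ := CStarAlgebra.nonneg_iff_eq_star_mul_self.mp h
    rw [map_mul, map_star]
    exact star_mul_self_nonneg _

theorem WStarRep.nonneg_iff {a : A} : 0 ≤ a ↔ ∀ ξ, 0 ≤ ⟪ξ, r.rep a ξ⟫_ℂ := by
  rw [← r.rep_nonneg_iff, clm_nonneg_iff]

omit [PartialOrder A] [StarOrderedRing A] in
/-- The functional `a ↦ ⟨ξ, a η⟩`. -/
def WStarRep.vectorForm (ξ η : HA) : A →ₗ[ℂ] ℂ where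
  toFun a := ⟪ξ, r.rep a η⟫_ℂ
  map_add' a a' := by rw [map_add, add_apply, inner_add_right]
  map_smul' z a := by rw [map_smul, smul_apply, inner_smul_right]; rfl

/-- Follows from 0 ≤ x − a ≤ x − a₀; it bounds the tail of an increasing net in norm. -/
theorem norm_le_of_le_of_le {a₀ a x : A} (h₀ : a₀ ≤ a) (h : a ≤ x) :
    ‖a‖ ≤ ‖x‖ + ‖x - a₀‖ := by
  have h1 : ‖x - a‖ ≤ ‖x - a₀‖ :=
    CStarAlgebra.norm_le_norm_of_nonneg_of_le (sub_nonneg.mpr h) (sub_le_sub_left h₀ x)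
  have h2 : ‖a‖ = ‖x - (x - a)‖ := by rw [sub_sub_cancel]
  rw [h2]
  exact (norm_sub_le _ _).trans (by gcongr)

/-- Vector functionals are normal. -/
theorem WStarRep.isNormalPositive (ξ : HA) : IsNormalPositive (r.vectorForm ξ ξ) := by
  refine ⟨fun a ha => r.nonneg_iff.mp ha ξ, fun s hs hd _ x hx => ⟨?_, ?_⟩⟩
  · rintro _ ⟨a, ha, rfl⟩
    rw [← sub_nonneg, ← map_sub]
    exact r.nonneg_iff.mp (sub_nonneg.mpr (hx.1 ha)) ξ
  · intro y hy
    -- The weak limit of the net commutes with the commutant, so it is the image of some t in A. It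
    -- majorizes s, hence x ≤ t, while ⟨ξ, tξ⟩ is a limit of values bounded by y.
    obtain ⟨𝓤, h𝓤, h𝓤'⟩ := exists_ultrafilter_directedOn hs hd
    obtain ⟨a₀, ha₀⟩ := hs
    obtain ⟨T, hT⟩ := exists_weak_limit 𝓤 (fun a => r.rep a) (C := ‖x‖ + ‖x - a₀‖) (by
      filter_upwards [h𝓤, h𝓤' a₀ ha₀] with a h1 h2
      rw [r.norm_rep]
      exact norm_le_of_le_of_le h2 (hx.1 h1))
    obtain ⟨t, rfl⟩ := r.exists_rep_eq (T := T) fun u hu => by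
      refine ContinuousLinearMap.ext fun η => ext_inner_left ℂ fun ζ => ?_
      change ⟪ζ, u (T η)⟫_ℂ = ⟪ζ, T (u η)⟫_ℂ
      rw [← ContinuousLinearMap.adjoint_inner_left]
      refine tendsto_nhds_unique (hT _ _) ((hT _ _).congr fun a => ?_)
      rw [ContinuousLinearMap.adjoint_inner_left]
      exact congrArg (fun S : HA →L[ℂ] HA => ⟪ζ, S η⟫_ℂ) (hu a).symm
    have hxt : x ≤ t := hx.2 fun a ha => by
      rw [← sub_nonneg, r.nonneg_iff]
      intro η
      rw [map_sub, sub_apply, inner_sub_right, sub_nonneg]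
      refine ge_of_tendsto (hT η η) ?_
      filter_upwards [h𝓤' a ha] with b hb
      rw [← sub_nonneg, ← inner_sub_right, ← sub_apply, ← map_sub]
      exact r.nonneg_iff.mp (sub_nonneg.mpr hb) η
    refine le_trans (b := ⟪ξ, r.rep t ξ⟫_ℂ) ?_ ?_
    · change r.vectorForm ξ ξ x ≤ r.vectorForm ξ ξ t
      rw [← sub_nonneg, ← map_sub]
      exact r.nonneg_iff.mp (sub_nonneg.mpr hxt) ξ
    · refine le_of_tendsto (hT ξ ξ) ?_
      filter_upwards [h𝓤] with a ha
      exact hy ⟨a, ha, rfl⟩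

end Rep

/-! ### Density in the topologies defined by normal functionals -/

section Tau

variable {A V B HA M : Type*} [NonUnitalCStarAlgebra A] [PartialOrder A] [StarOrderedRing A]
  [NormedAddCommGroup HA] [InnerProductSpace ℂ HA] [CompleteSpace HA]
  [AddCommGroup V] [Module ℂ V] [CStarAlgebra B]
  [NormedAddCommGroup M] [NormedSpace ℂ M] [SMul Aᵐᵒᵖ M] [HilbertModule A M]
  {π : B →⋆ₐ[ℂ] AdjOp A M} {K : V →ₗ[ℂ] M}

/-- Vector functionals are normal, so both topologies control them. If m is orthogonal to the span,
then ⟨m−d, m−d⟩ = ⟨m,m⟩ + ⟨d,d⟩ (for τ₁) and ⟨m, m−d⟩ = ⟨m,m⟩ (for τ₂) for d in the span, so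
approximation of m by d forces ⟨m,m⟩ = 0. -/
theorem isSeparating_of_tau_dense (r : WStarRep A HA)
    (h : IsTauOneDense A (dilationSpan π K) ∨ IsTauTwoDense A (dilationSpan π K)) :
    IsSeparating π K := by
  classical
  intro m hm
  have hspan : ∀ d ∈ dilationSpan π K, inner A m d = 0 := by
    intro d hd
    rw [dilationSpan_eq] at hd
    have : Submodule.span ℂ (Set.range (dilationVec π K)) ≤ LinearMap.ker (innerSesq A M m) := by
      rw [Submodule.span_le]
      rintro _ ⟨p, rfl⟩
      change inner A m (dilationVec π K p) = 0
      rw [← HilbertModule.star_inner, hm, star_zero]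
    exact this hd
  refine HilbertModule.inner_self_eq_zero (A := A) m (r.rep_injective ?_)
  rw [map_zero]
  have hpos : ∀ x : M, 0 ≤ r.rep (inner A x x) := fun x =>
    r.rep_nonneg_iff.mpr (HilbertModule.inner_self_nonneg x)
  refine ContinuousLinearMap.ext fun ξ => clm_apply_eq_zero_of_nonneg (hpos m) ?_
  have hre : ∀ x : M, 0 ≤ ⟪ξ, r.rep (inner A x x) ξ⟫_ℂ := fun x => clm_nonneg_iff.mp (hpos x) ξ
  suffices hlt : ∀ ε : ℝ, 0 < ε → (⟪ξ, r.rep (inner A m m) ξ⟫_ℂ).re ≤ ε by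
    have h0 := RCLike.nonneg_iff.mp (hre m)
    exact Complex.ext (le_antisymm (le_of_forall_pos_le_add fun ε hε => by simpa using hlt ε hε)
      h0.1) h0.2
  intro ε hε
  have hsub : ∀ d ∈ dilationSpan π K, inner A m (m - d) = inner A m m := fun d hd => by
    rw [inner_sub_right_hilbertModule, hspan d hd, sub_zero]
  rcases h with h | h
  · obtain ⟨d, hd, hlt⟩ := h m {r.vectorForm ξ ξ} (by simpa using r.isNormalPositive ξ)
      (√ε) (Real.sqrt_pos.mpr hε)
    have h1 := hlt _ (Finset.mem_singleton_self _)
    have h2 := (Real.sqrt_lt_sqrt_iff_of_pos hε).mp h1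
    have h3 : inner A (m - d) (m - d) = inner A m m + inner A d d := by
      rw [inner_sub_left_hilbertModule, hsub d hd, inner_sub_right_hilbertModule,
        ← HilbertModule.star_inner m d, hspan d hd]
      simp
    rw [h3, map_add, Complex.add_re] at h2
    have h4 := (RCLike.nonneg_iff.mp (hre d)).1
    change (⟪ξ, r.rep (inner A m m) ξ⟫_ℂ).re + (⟪ξ, r.rep (inner A d d) ξ⟫_ℂ).re < ε at h2
    change 0 ≤ (⟪ξ, r.rep (inner A d d) ξ⟫_ℂ).re at h4
    linarith
  · obtain ⟨d, hd, hlt⟩ := h m {(r.vectorForm ξ ξ, m)} (by simpa using r.isNormalPositive ξ)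
      ε hε
    have h1 := hlt _ (Finset.mem_singleton_self _)
    rw [hsub d hd] at h1
    exact (Complex.re_le_norm _).trans h1.le

end Tau

/-! ### Positive kernels in a representation -/

section Gram

variable {A HA : Type*} [NonUnitalCStarAlgebra A] [PartialOrder A] [StarOrderedRing A]
  [NormedAddCommGroup HA] [InnerProductSpace ℂ HA] [CompleteSpace HA] (r : WStarRep A HA)

/-- A positive kernel with values in `A`, restricted to a finite set, yields a sum of squares in
every representation. -/
theorem WStarRep.exists_gram (r : WStarRep A HA) {ι : Type*} (s : Finset ι) (N : ι → ι → A)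
    (hN : ∀ i j, star (N i j) = N j i)
    (h : ∀ a : ι → A, 0 ≤ ∑ i ∈ s, ∑ j ∈ s, star (a i) * N i j * a j) :
    ∃ R : s → s → A, ∀ ξ : ι → HA, ∑ i ∈ s, ∑ j ∈ s, ⟪ξ i, r.rep (N i j) (ξ j)⟫_ℂ =
      ∑ k, ⟪∑ j, r.rep (R k j) (ξ j), ∑ j, r.rep (R k j) (ξ j)⟫_ℂ := by
  classical
  obtain ⟨R, hR⟩ := exists_gram_factorization (fun i j : s => N i j) (fun i j => hN i j)
    (fun a => by
      have h1 := h fun i => if hi : i ∈ s then a ⟨i, hi⟩ else 0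
      rw [← Finset.sum_coe_sort] at h1
      simp_rw [← Finset.sum_coe_sort s fun j => _] at h1
      simpa using h1)
  have key : ∀ (ξ : ι → HA) (i j : s), ⟪ξ i, r.rep (N i j) (ξ j)⟫_ℂ =
      ∑ k, ⟪r.rep (R k i) (ξ i), r.rep (R k j) (ξ j)⟫_ℂ := fun ξ i j => by
    have h1 : r.rep (N i j) = ∑ k, star (r.rep (R k i)) * r.rep (R k j) := by
      rw [show N i j = _ from hR i j, map_sum]
      exact Finset.sum_congr rfl fun k _ => by rw [map_mul, map_star]
    have h2 : r.rep (N i j) (ξ j) = ∑ k, star (r.rep (R k i)) (r.rep (R k j) (ξ j)) := by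
      rw [h1, sum_apply]
      rfl
    rw [h2, inner_sum]
    refine Finset.sum_congr rfl fun k _ => ?_
    rw [ContinuousLinearMap.star_eq_adjoint, ContinuousLinearMap.adjoint_inner_right]
  have key' : ∀ (ξ : ι → HA) (k : s),
      ⟪∑ j, r.rep (R k j) (ξ j), ∑ j, r.rep (R k j) (ξ j)⟫_ℂ =
        ∑ i, ∑ j, ⟪r.rep (R k i) (ξ i), r.rep (R k j) (ξ j)⟫_ℂ := fun ξ k => by
    rw [sum_inner]
    exact Finset.sum_congr rfl fun i _ => inner_sum _ _ _
  refine ⟨R, fun ξ => ?_⟩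
  calc ∑ i ∈ s, ∑ j ∈ s, ⟪ξ i, r.rep (N i j) (ξ j)⟫_ℂ
      = ∑ i : s, ∑ j : s, ⟪ξ i, r.rep (N i j) (ξ j)⟫_ℂ := by
        rw [← Finset.sum_coe_sort]
        exact Finset.sum_congr rfl fun i _ =>
          (Finset.sum_coe_sort s fun j => ⟪ξ i, r.rep (N i j) (ξ j)⟫_ℂ).symm
    _ = ∑ i : s, ∑ k : s, ∑ j : s, ⟪r.rep (R k i) (ξ i), r.rep (R k j) (ξ j)⟫_ℂ :=
        Finset.sum_congr rfl fun i _ => by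
          rw [Finset.sum_comm]
          exact Finset.sum_congr rfl fun j _ => key ξ i j
    _ = _ := by
        rw [Finset.sum_comm]
        exact Finset.sum_congr rfl fun k _ => (key' ξ k).symm

theorem WStarRep.sum_inner_nonneg {ι : Type*} (s : Finset ι) (N : ι → ι → A)
    (hN : ∀ i j, star (N i j) = N j i)
    (h : ∀ a : ι → A, 0 ≤ ∑ i ∈ s, ∑ j ∈ s, star (a i) * N i j * a j) (ξ : ι → HA) :
    0 ≤ ∑ i ∈ s, ∑ j ∈ s, ⟪ξ i, r.rep (N i j) (ξ j)⟫_ℂ := by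
  obtain ⟨R, hR⟩ := r.exists_gram s N hN h
  rw [hR]
  exact Finset.sum_nonneg fun k _ => by
    rw [inner_self_eq_norm_sq_to_K, ← RCLike.ofReal_pow]
    exact Complex.zero_le_real.mpr (sq_nonneg _)

/-- In the sum of squares from `exists_gram`, u commutes with the entries of R and leaves each
square at the cost of a factor ‖u‖². -/
theorem WStarRep.sum_inner_comm_le {ι : Type*} (s : Finset ι) (N : ι → ι → A)
    (hN : ∀ i j, star (N i j) = N j i)
    (h : ∀ a : ι → A, 0 ≤ ∑ i ∈ s, ∑ j ∈ s, star (a i) * N i j * a j) (ξ : ι → HA)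
    {u : HA →L[ℂ] HA} (hu : ∀ a, u * r.rep a = r.rep a * u) :
    ‖∑ i ∈ s, ∑ j ∈ s, ⟪u (ξ i), r.rep (N i j) (u (ξ j))⟫_ℂ‖ ≤
      ‖u‖ ^ 2 * ‖∑ i ∈ s, ∑ j ∈ s, ⟪ξ i, r.rep (N i j) (ξ j)⟫_ℂ‖ := by
  obtain ⟨R, hR⟩ := r.exists_gram s N hN h
  have hu' : ∀ a ζ, r.rep a (u ζ) = u (r.rep a ζ) := fun a ζ =>
    (congrArg (fun T : HA →L[ℂ] HA => T ζ) (hu a)).symm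
  rw [hR fun i => u (ξ i), hR ξ]
  simp_rw [hu', ← map_sum, inner_self_eq_norm_sq_to_K]
  have h2 : ∀ f : s → ℝ, (∀ k, 0 ≤ f k) → ‖∑ k, ((f k : ℝ) : ℂ)‖ = ∑ k, f k := fun f hf => by
    rw [← Complex.ofReal_sum, Complex.norm_real,
      Real.norm_of_nonneg (Finset.sum_nonneg fun k _ => hf k)]
  have h3 := h2 (fun k => ‖u (∑ j, r.rep (R k j) (ξ j))‖ ^ 2) fun k => sq_nonneg _
  have h4 := h2 (fun k => ‖∑ j, r.rep (R k j) (ξ j)‖ ^ 2) fun k => sq_nonneg _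
  simp only [Complex.ofReal_pow] at h3 h4
  refine (h3.le.trans ?_).trans_eq (congrArg (‖u‖ ^ 2 * ·) h4.symm)
  rw [Finset.mul_sum]
  refine Finset.sum_le_sum fun k _ => ?_
  rw [← mul_pow]
  gcongr
  exact u.le_opNorm _

end Gram

/-! ### Operators given by kernels -/

section Kernel

variable {X : Type*} [NormedAddCommGroup X] [InnerProductSpace ℂ X] {ι : Type*} {x : ι → X}

theorem ext_inner_of_dense_span (hx : Dense (Submodule.span ℂ (Set.range x) : Set X)) {y y' : X}
    (h : ∀ i, ⟪x i, y⟫_ℂ = ⟪x i, y'⟫_ℂ) : y = y' := by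
  refine hx.eq_of_inner_right ℂ fun v hv => ?_
  induction hv using Submodule.span_induction with
  | mem v hv => obtain ⟨i, rfl⟩ := hv; exact h i
  | zero => simp
  | add v w _ _ hv hw => rw [inner_add_left, inner_add_left, hv, hw]
  | smul z v _ hv => rw [inner_smul_left, inner_smul_left, hv]

theorem clm_ext_of_dense_span (hx : Dense (Submodule.span ℂ (Set.range x) : Set X))
    {T T' : X →L[ℂ] X} (h : ∀ i j, ⟪x i, T (x j)⟫_ℂ = ⟪x i, T' (x j)⟫_ℂ) : T = T' := by
  refine ContinuousLinearMap.ext_on hx ?_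
  rintro _ ⟨j, rfl⟩
  exact ext_inner_of_dense_span hx fun i => h i j

theorem exists_clm_of_kernel [CompleteSpace X]
    (hx : Dense (Submodule.span ℂ (Set.range x) : Set X)) (k : ι → ι → ℂ) {C : ℝ} (hC : 0 ≤ C)
    (hk : ∀ (s : Finset ι) (z : ι → ℂ),
      ‖∑ i ∈ s, ∑ j ∈ s, (star (z i) * z j) • k i j‖ ≤ C * ‖∑ i ∈ s, z i • x i‖ ^ 2) :
    ∃ T : X →L[ℂ] X, ∀ i j, ⟪x i, T (x j)⟫_ℂ = k i j := by
  obtain ⟨t, ht⟩ := exists_sesq_extension x hx k hC hk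
  refine ⟨ContinuousLinearMap.adjoint (InnerProductSpace.continuousLinearMapOfBilin t),
    fun i j => ?_⟩
  rw [ContinuousLinearMap.adjoint_inner_right,
    InnerProductSpace.continuousLinearMapOfBilin_apply, ht]

end Kernel

/-! ### The interior tensor product of a Hilbert module with a representation -/

/-- The interior tensor product `X = M ⊗_A H` given by the operators `θ_m : ξ ↦ m ⊗ ξ`. -/
structure InteriorTensor {A HA : Type*} [NonUnitalCStarAlgebra A] [PartialOrder A]
    [NormedAddCommGroup HA] [InnerProductSpace ℂ HA] [CompleteSpace HA] (r : WStarRep A HA)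
    (M X : Type*) [NormedAddCommGroup M] [NormedSpace ℂ M] [SMul Aᵐᵒᵖ M] [HilbertModule A M]
    [NormedAddCommGroup X] [InnerProductSpace ℂ X] where
  /-- the operator `ξ ↦ m ⊗ ξ` -/
  op : M → HA →L[ℂ] X
  inner_op : ∀ m n ξ η, ⟪op m ξ, op n η⟫_ℂ = ⟪ξ, r.rep (inner A m n) η⟫_ℂ
  dense : Dense (Submodule.span ℂ (Set.range fun p : M × HA => op p.1 p.2) : Set X)

section Interior

universe uH uM

variable {A : Type*} {HA : Type uH} {M : Type uM} [NonUnitalCStarAlgebra A] [PartialOrder A]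
  [NormedAddCommGroup HA] [InnerProductSpace ℂ HA] [CompleteSpace HA] (r : WStarRep A HA)
  [NormedAddCommGroup M] [NormedSpace ℂ M] [SMul Aᵐᵒᵖ M] [HilbertModule A M]

/-- The sum is the inner square of ∑ m_i a_i. -/
theorem sum_star_mul_inner_mul_nonneg {ι : Type*} (s : Finset ι) (m : ι → M) (a : ι → A) :
    0 ≤ ∑ i ∈ s, ∑ j ∈ s, star (a i) * inner A (m i) (m j) * a j := by
  refine (HilbertModule.inner_self_nonneg (A := A) (∑ i ∈ s, m i <• a i)).trans_eq ?_
  change innerSesq A M _ _ = _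
  simp only [map_sum, LinearMap.sum_apply]
  rw [Finset.sum_comm]
  refine Finset.sum_congr rfl fun i _ => Finset.sum_congr rfl fun j _ => ?_
  change inner A (m i <• a i) (m j <• a j) = _
  rw [HilbertModule.inner_act_left, HilbertModule.inner_act_right, mul_assoc]

/-- The space is the reproducing kernel Hilbert space of the operator-valued kernel (m,n) ↦ ⟨m,n⟩ on
H. No quotient is needed: linearity in m and ma ⊗ ξ = m ⊗ aξ follow from the inner product formula
and density. -/
theorem exists_interiorTensor [StarOrderedRing A] :
    ∃ (X : Type (max uM uH)) (_ : NormedAddCommGroup X) (_ : InnerProductSpace ℂ X) (_ : CompleteSpace X),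
      Nonempty (InteriorTensor r M X) := by
  let N : Matrix M M (HA →L[ℂ] HA) := Matrix.of fun m n => r.rep (inner A m n)
  have hN : N.PosSemidef := by
    have htfae := (RKHS.posSemidef_tfae (K := N)).out 2 0
    refine htfae.mp ⟨?_, fun f => ?_⟩
    · ext m n : 1
      change star (r.rep (inner A n m)) = r.rep (inner A m n)
      rw [← map_star, HilbertModule.star_inner]
    · have h := r.sum_inner_nonneg f.support (fun m n => inner A m n)
        (fun m n => HilbertModule.star_inner m n)
        (fun a => sum_star_mul_inner_mul_nonneg f.support id a) f
      have h2 : (f.sum fun m w => f.sum fun m' w' => ⟪N m' m w, w'⟫_ℂ) =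
          ∑ i ∈ f.support, ∑ j ∈ f.support, ⟪f i, r.rep (inner A i j) (f j)⟫_ℂ := by
        refine Finset.sum_congr rfl fun i _ => Finset.sum_congr rfl fun j _ => ?_
        change ⟪r.rep (inner A j i) (f i), f j⟫_ℂ = _
        rw [← ContinuousLinearMap.adjoint_inner_right, ← ContinuousLinearMap.star_eq_adjoint,
          ← map_star, HilbertModule.star_inner]
      rw [h2]
      exact (RCLike.nonneg_iff.mp h).1
  have : Fact N.PosSemidef := ⟨hN⟩
  refine ⟨RKHS.OfKernel N, inferInstance, inferInstance, inferInstance, ⟨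
    { op := RKHS.kerFun (RKHS.OfKernel N)
      inner_op := fun m n ξ η => ?_
      dense := ?_ }⟩⟩
  · rw [← RKHS.kernel_inner, RKHS.OfKernel.kernel_ofKernel]
    change ⟪r.rep (inner A n m) ξ, η⟫_ℂ = _
    rw [← ContinuousLinearMap.adjoint_inner_right, ← ContinuousLinearMap.star_eq_adjoint,
      ← map_star, HilbertModule.star_inner]
  · rw [Submodule.dense_iff_topologicalClosure_eq_top, ← RKHS.kerFun_dense (RKHS.OfKernel N)]
    congr 2
    ext y
    simp

end Interior

namespace InteriorTensor

variable {A HA M X : Type*} [NonUnitalCStarAlgebra A] [PartialOrder A]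
  [NormedAddCommGroup HA] [InnerProductSpace ℂ HA] [CompleteSpace HA] {r : WStarRep A HA}
  [NormedAddCommGroup M] [NormedSpace ℂ M] [SMul Aᵐᵒᵖ M] [HilbertModule A M]
  [NormedAddCommGroup X] [InnerProductSpace ℂ X] (θ : InteriorTensor r M X)

theorem ext {y y' : X} (h : ∀ m ξ, ⟪θ.op m ξ, y⟫_ℂ = ⟪θ.op m ξ, y'⟫_ℂ) : y = y' :=
  ext_inner_of_dense_span θ.dense fun p => h p.1 p.2

theorem op_add (m n : M) (ξ : HA) : θ.op (m + n) ξ = θ.op m ξ + θ.op n ξ :=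
  θ.ext fun k ζ => by
    rw [inner_add_right, inner_op, inner_op, inner_op, HilbertModule.inner_add_right, map_add,
      add_apply, inner_add_right]

theorem op_smul (z : ℂ) (m : M) (ξ : HA) : θ.op (z • m) ξ = z • θ.op m ξ :=
  θ.ext fun k ζ => by
    rw [inner_smul_right, inner_op, inner_op, HilbertModule.inner_smul_right, map_smul,
      smul_apply, inner_smul_right]

theorem op_act (m : M) (a : A) (ξ : HA) : θ.op (m <• a) ξ = θ.op m (r.rep a ξ) :=
  θ.ext fun k ζ => by
    rw [inner_op, inner_op, HilbertModule.inner_act_right, map_mul]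
    rfl

theorem norm_op_le (m : M) : ‖θ.op m‖ ≤ ‖m‖ := by
  refine ContinuousLinearMap.opNorm_le_bound _ (norm_nonneg _) fun ξ => ?_
  refine (sq_le_sq₀ (norm_nonneg _) (by positivity)).mp ?_
  have h := θ.inner_op m m ξ ξ
  rw [inner_self_eq_norm_sq_to_K] at h
  have h' : ‖θ.op m ξ‖ ^ 2 = ‖⟪ξ, r.rep (inner A m m) ξ⟫_ℂ‖ := by
    rw [← h]; simp
  rw [h', mul_pow, HilbertModule.norm_sq (A := A) m, ← r.norm_rep, sq ‖ξ‖]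
  refine (norm_inner_le_norm _ _).trans ?_
  rw [mul_left_comm]
  gcongr
  exact ContinuousLinearMap.le_opNorm _ _

variable [CompleteSpace X]

/-- The operators on the interior tensor product that commute with the commutant of `A`. -/
def IsInvariant (T : X →L[ℂ] X) : Prop :=
  ∀ u : HA →L[ℂ] HA, (∀ a, u * r.rep a = r.rep a * u) → ∀ m n ξ η,
    ⟪θ.op m ξ, T (θ.op n (u η))⟫_ℂ = ⟪θ.op m (star u ξ), T (θ.op n η)⟫_ℂ

end InteriorTensor

theorem inner_star_clm {X : Type*} [NormedAddCommGroup X] [InnerProductSpace ℂ X]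
    [CompleteSpace X] (T : X →L[ℂ] X) (x y : X) : ⟪(star T) x, y⟫_ℂ = ⟪x, T y⟫_ℂ :=
  ContinuousLinearMap.adjoint_inner_left _ _ _

theorem inner_clm_star {X : Type*} [NormedAddCommGroup X] [InnerProductSpace ℂ X]
    [CompleteSpace X] (T : X →L[ℂ] X) (x y : X) : ⟪x, (star T) y⟫_ℂ = ⟪T x, y⟫_ℂ :=
  ContinuousLinearMap.adjoint_inner_right _ _ _

section Rep

variable {A HA : Type*} [NonUnitalCStarAlgebra A]
  [NormedAddCommGroup HA] [InnerProductSpace ℂ HA] [CompleteSpace HA] (r : WStarRep A HA)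

theorem WStarRep.rep_mul_apply (a b : A) (η : HA) : r.rep (a * b) η = r.rep a (r.rep b η) := by
  rw [map_mul]; rfl

theorem WStarRep.inner_rep_star (a : A) (ξ η : HA) :
    ⟪ξ, r.rep (star a) η⟫_ℂ = ⟪r.rep a ξ, η⟫_ℂ := by
  rw [map_star, inner_clm_star]

theorem WStarRep.ext_inner {a b : A} (h : ∀ ξ η, ⟪ξ, r.rep a η⟫_ℂ = ⟪ξ, r.rep b η⟫_ℂ) : a = b :=
  r.rep_injective (ContinuousLinearMap.ext fun η => ext_inner_left ℂ fun ξ => h ξ η)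

end Rep

/-! ### Ampliations, and the descent of invariant operators from X to M. -/

namespace InteriorTensor

variable {A HA M X : Type*} [NonUnitalCStarAlgebra A] [PartialOrder A] [StarOrderedRing A]
  [NormedAddCommGroup HA] [InnerProductSpace ℂ HA] [CompleteSpace HA] {r : WStarRep A HA}
  [NormedAddCommGroup M] [NormedSpace ℂ M] [SMul Aᵐᵒᵖ M] [HilbertModule A M]
  [NormedAddCommGroup X] [InnerProductSpace ℂ X] (θ : InteriorTensor r M X)

omit [StarOrderedRing A] in
theorem inner_sum_op {ι : Type*} (s : Finset ι) (m : ι → M) (ξ : ι → HA) :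
    ⟪∑ i ∈ s, θ.op (m i) (ξ i), ∑ i ∈ s, θ.op (m i) (ξ i)⟫_ℂ =
      ∑ i ∈ s, ∑ j ∈ s, ⟪ξ i, r.rep (inner A (m i) (m j)) (ξ j)⟫_ℂ := by
  rw [sum_inner]
  exact Finset.sum_congr rfl fun i _ => (inner_sum _ _ _).trans
    (Finset.sum_congr rfl fun j _ => θ.inner_op _ _ _ _)

theorem norm_sum_op_comm_le {ι : Type*} (s : Finset ι) (m : ι → M) (ξ : ι → HA)
    {u : HA →L[ℂ] HA} (hu : ∀ a, u * r.rep a = r.rep a * u) :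
    ‖∑ i ∈ s, θ.op (m i) (u (ξ i))‖ ≤ ‖u‖ * ‖∑ i ∈ s, θ.op (m i) (ξ i)‖ := by
  have h := r.sum_inner_comm_le s (fun i j => inner A (m i) (m j))
    (fun i j => HilbertModule.star_inner _ _) (sum_star_mul_inner_mul_nonneg s m) ξ hu
  rw [← θ.inner_sum_op s m ξ, ← θ.inner_sum_op s m fun i => u (ξ i), inner_self_eq_norm_sq_to_K,
    inner_self_eq_norm_sq_to_K] at h
  simp only [norm_pow, RCLike.norm_ofReal, abs_norm] at h
  rw [← mul_pow] at h
  exact (sq_le_sq₀ (norm_nonneg _) (by positivity)).mp h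

variable [CompleteSpace X]

/-- An operator commuting with `A` acts on the second factor of the interior tensor product. -/
theorem exists_ampliation {u : HA →L[ℂ] HA} (hu : ∀ a, u * r.rep a = r.rep a * u) :
    ∃ û : X →L[ℂ] X, (∀ n η, û (θ.op n η) = θ.op n (u η)) ∧
      ∀ n η, (star û) (θ.op n η) = θ.op n (star u η) := by
  obtain ⟨û, hû⟩ := exists_clm_of_kernel θ.dense
    (fun p q => ⟪θ.op p.1 p.2, θ.op q.1 (u q.2)⟫_ℂ) (norm_nonneg u) (fun s z => by
      have h1 : ∑ i ∈ s, ∑ j ∈ s, (star (z i) * z j) • ⟪θ.op i.1 i.2, θ.op j.1 (u j.2)⟫_ℂ =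
          ⟪∑ i ∈ s, θ.op i.1 (z i • i.2), ∑ j ∈ s, θ.op j.1 (u (z j • j.2))⟫_ℂ := by
        rw [sum_inner]
        refine Finset.sum_congr rfl fun i _ => ?_
        rw [inner_sum]
        refine Finset.sum_congr rfl fun j _ => ?_
        rw [map_smul, map_smul, map_smul, inner_smul_left, inner_smul_right, smul_eq_mul,
          mul_assoc]
        rfl
      rw [h1]
      simp_rw [← map_smul]
      refine (norm_inner_le_norm _ _).trans ?_
      have h2 := θ.norm_sum_op_comm_le s (fun p => p.1) (fun p => z p • p.2) hu
      calc _ ≤ ‖∑ i ∈ s, θ.op i.1 (z i • i.2)‖ * (‖u‖ * ‖∑ i ∈ s, θ.op i.1 (z i • i.2)‖) := by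
            gcongr
        _ = _ := by ring)
  have h1 : ∀ n η, û (θ.op n η) = θ.op n (u η) := fun n η =>
    θ.ext fun m ξ => hû (m, ξ) (n, η)
  refine ⟨û, h1, fun n η => θ.ext fun m ξ => ?_⟩
  -- Commutation of u with ⟨m,n⟩* is what lets u* pass ⟨m,n⟩.
  have h2 := congrArg (fun T : HA →L[ℂ] HA => T ξ) (hu (star (inner A m n)))
  change u (r.rep _ ξ) = r.rep _ (u ξ) at h2
  rw [inner_clm_star, h1, inner_op, inner_op, ← star_star (inner A m n), r.inner_rep_star,
    r.inner_rep_star, inner_clm_star, h2]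

variable {θ}

/-- Invariance says that θ_m* T θ_n commutes with the commutant of A, so it is the image of some
s(m,n) in A. The form s is A-sesquilinear and bounded by ‖T‖, and self-duality represents it. -/
theorem IsInvariant.exists_adjOp (hM : IsSelfDual A M) {T : X →L[ℂ] X} (hT : θ.IsInvariant T) :
    ∃ E : AdjOp A M, ∀ m n ξ η,
      ⟪ξ, r.rep (inner A m (E.1 n)) η⟫_ℂ = ⟪θ.op m ξ, T (θ.op n η)⟫_ℂ := by
  have h0 : ∀ (m n : M) (ξ η : HA),
      ⟪ξ, ((ContinuousLinearMap.adjoint (θ.op m)) ∘L (T ∘L θ.op n)) η⟫_ℂ =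
        ⟪θ.op m ξ, T (θ.op n η)⟫_ℂ := fun m n ξ η => by
    rw [ContinuousLinearMap.comp_apply, ContinuousLinearMap.adjoint_inner_right]
    rfl
  have h1 : ∀ m n : M,
      ∃ a : A, r.rep a = (ContinuousLinearMap.adjoint (θ.op m)) ∘L (T ∘L θ.op n) := fun m n => by
    refine r.exists_rep_eq fun u hu => ?_
    refine ContinuousLinearMap.ext fun η => ext_inner_left ℂ fun ξ => ?_
    rw [ContinuousLinearMap.mul_def, ContinuousLinearMap.mul_def, ContinuousLinearMap.comp_apply,
      ContinuousLinearMap.comp_apply _ u, ← inner_star_clm, h0, h0, hT u hu]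
  choose s hs using h1
  have hs' : ∀ m n ξ η, ⟪ξ, r.rep (s m n) η⟫_ℂ = ⟪θ.op m ξ, T (θ.op n η)⟫_ℂ := fun m n ξ η => by
    rw [hs, h0]
  have hmem : s ∈ SesqForm A M := by
    refine ⟨fun u v w z => r.ext_inner fun ξ η => ?_, fun u v w z => r.ext_inner fun ξ η => ?_,
      fun u v a => r.ext_inner fun ξ η => ?_, fun u v a => r.ext_inner fun ξ η => ?_⟩
    · rw [map_add, map_smul, add_apply, smul_apply, inner_add_right, inner_smul_right, hs', hs',
        hs', op_add, op_smul, map_add, map_smul, inner_add_right, inner_smul_right]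
    · rw [map_add, map_smul, add_apply, smul_apply, inner_add_right, inner_smul_right, hs', hs',
        hs', op_add, op_smul, inner_add_left, inner_smul_left]
      rfl
    · rw [r.rep_mul_apply, hs', hs', op_act]
    · rw [r.rep_mul_apply, map_star, inner_clm_star, hs', hs', op_act]
  have hnorm : ∀ m n, ‖s m n‖ ≤ ‖T‖ * ‖m‖ * ‖n‖ := fun m n => by
    rw [← r.norm_rep, hs]
    have h2 : ‖ContinuousLinearMap.adjoint (θ.op m)‖ ≤ ‖m‖ := by
      rw [LinearIsometryEquiv.norm_map]
      exact θ.norm_op_le m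
    have h3 : ‖T ∘L θ.op n‖ ≤ ‖T‖ * ‖n‖ := (ContinuousLinearMap.opNorm_comp_le _ _).trans
      (by gcongr; exact θ.norm_op_le n)
    calc _ ≤ ‖ContinuousLinearMap.adjoint (θ.op m)‖ * ‖T ∘L θ.op n‖ :=
          ContinuousLinearMap.opNorm_comp_le _ _
      _ ≤ ‖m‖ * (‖T‖ * ‖n‖) := by gcongr
      _ = _ := by ring
  obtain ⟨E, hE⟩ := exists_adjOp_of_sesqForm hM ⟨s, hmem⟩ hnorm
  exact ⟨E, fun m n ξ η => by rw [hE, ← hs']⟩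

theorem isInvariant_of_commute {T : X →L[ℂ] X}
    (h : ∀ û : X →L[ℂ] X, ∀ u : HA →L[ℂ] HA, (∀ a, u * r.rep a = r.rep a * u) →
      (∀ n η, û (θ.op n η) = θ.op n (u η)) → (∀ n η, (star û) (θ.op n η) = θ.op n (star u η)) →
      ∀ x y, ⟪x, T (û y)⟫_ℂ = ⟪star û x, T y⟫_ℂ) :
    θ.IsInvariant T := fun u hu m n ξ η => by
  obtain ⟨û, h1, h2⟩ := θ.exists_ampliation hu
  rw [← h1, ← h2]
  exact h û u hu h1 h2 _ _

variable (θ) in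
/-- In a self-dual module, a family with trivial orthogonal complement is total in the interior
tensor product. -/
theorem dense_span_of_separating (hM : IsSelfDual A M) {I : Type*} (x : I → M)
    (hx : ∀ m : M, (∀ i, inner A (x i) m = 0) → m = 0) :
    Dense (Submodule.span ℂ (Set.range fun p : I × HA => θ.op (x p.1) p.2) : Set X) := by
  -- Ampliations and their adjoints preserve Y, so its projection P is invariant and descends to
  -- some E with ⟨x_i, En⟩ = ⟨x_i, n⟩. Separation gives E = 1, so ⟨y, Py⟩ = ⟨y, y⟩ for y = n ⊗ η,
  -- and y lies in Y.
  let Y := (Submodule.span ℂ (Set.range fun p : I × HA => θ.op (x p.1) p.2)).topologicalClosure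
  have : CompleteSpace Y := (Submodule.isClosed_topologicalClosure _).completeSpace_coe
  have hmem : ∀ i ξ, θ.op (x i) ξ ∈ Y := fun i ξ =>
    Submodule.le_topologicalClosure _ (Submodule.subset_span ⟨(i, ξ), rfl⟩)
  have hpres : ∀ (û : X →L[ℂ] X) (u : HA →L[ℂ] HA), (∀ n η, û (θ.op n η) = θ.op n (u η)) →
      ∀ y ∈ Y, û y ∈ Y := fun û u hû y hy => by
    have h1 : Y ≤ Y.comap û.toLinearMap := by
      refine Submodule.topologicalClosure_minimal _ ?_
        ((Submodule.isClosed_topologicalClosure _).preimage û.continuous)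
      rw [Submodule.span_le]
      rintro _ ⟨⟨i, ξ⟩, rfl⟩
      change û (θ.op (x i) ξ) ∈ Y
      rw [hû]
      exact hmem _ _
    exact h1 hy
  have hP : ∀ y ∈ Y, Y.starProjection y = y := fun y hy =>
    Submodule.starProjection_eq_self_iff.mpr hy
  have hsymm : ∀ a b, ⟪a, Y.starProjection b⟫_ℂ = ⟪Y.starProjection a, b⟫_ℂ := fun a b =>
    (Submodule.inner_starProjection_left_eq_right Y a b).symm
  have hPm : ∀ a, Y.starProjection a ∈ Y := fun a => Submodule.starProjection_apply_mem _ _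
  have hst : ∀ (û : X →L[ℂ] X) a b, ⟪a, û b⟫_ℂ = ⟪star û a, b⟫_ℂ := fun û a b => by
    rw [inner_star_clm]
  have hinv : θ.IsInvariant Y.starProjection := isInvariant_of_commute fun û u _ h1 h2 a b => by
    rw [hsymm, hst, ← hP _ (hpres _ _ h2 _ (hPm a)), ← hsymm, ← hst, ← hsymm,
      hP _ (hpres _ _ h1 _ (hPm b)), hst]
  obtain ⟨E, hE⟩ := hinv.exists_adjOp hM
  have hE1 : ∀ n, E.1 n = n := fun n => by
    rw [← sub_eq_zero]
    refine hx _ fun i => ?_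
    rw [inner_sub_right_hilbertModule, sub_eq_zero]
    refine r.rep_injective (ContinuousLinearMap.ext fun η => ext_inner_left ℂ fun ξ => ?_)
    rw [hE, hsymm, hP _ (hmem _ _), inner_op]
  have hall : ∀ n η, θ.op n η ∈ Y := fun n η => by
    have h1 : ⟪θ.op n η, Y.starProjection (θ.op n η)⟫_ℂ = ⟪θ.op n η, θ.op n η⟫_ℂ := by
      rw [← hE, hE1, inner_op]
    have h2 : ⟪θ.op n η - Y.starProjection (θ.op n η),
        θ.op n η - Y.starProjection (θ.op n η)⟫_ℂ = 0 := by
      rw [inner_sub_left, inner_sub_right, inner_sub_right, ← hsymm, ← hsymm,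
        hP _ (hPm _), h1, sub_self]
    rw [sub_eq_zero.mp (inner_self_eq_zero.mp h2)]
    exact hPm _
  have htop : (⊤ : Submodule ℂ X) ≤ Y := by
    rw [← Submodule.dense_iff_topologicalClosure_eq_top.mp θ.dense]
    refine Submodule.topologicalClosure_minimal _ ?_ (Submodule.isClosed_topologicalClosure _)
    rw [Submodule.span_le]
    rintro _ ⟨⟨n, η⟩, rfl⟩
    exact hall n η
  exact Submodule.dense_iff_topologicalClosure_eq_top.mpr (top_le_iff.mp htop)

end InteriorTensor

/-! ### Lifting the kernel of a completely positive map to the interior tensor product -/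

section Lift

variable {A V B C G H₁ H₂ M HA X : Type*} [NonUnitalCStarAlgebra A] [PartialOrder A]
  [StarOrderedRing A] [AddCommGroup V] [Module ℂ V] [SMul Aᵐᵒᵖ V] [CStarAlgebra B] [CStarAlgebra C]
  [NormedAddCommGroup H₁] [InnerProductSpace ℂ H₁] [CompleteSpace H₁]
  [NormedAddCommGroup H₂] [InnerProductSpace ℂ H₂] [CompleteSpace H₂]
  {r₁ : WStarRep B H₁} {r₂ : WStarRep C H₂}
  [NormedAddCommGroup HA] [InnerProductSpace ℂ HA] [CompleteSpace HA]
  {S : WTensor r₁ r₂ →ₗ[ℂ] SesqForm A V}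

/-- The coefficients a_i demanded by `WStarRep.sum_inner_nonneg` are absorbed into the vectors as
v_i a_i. -/
theorem IsCP.sum_inner_tensorKernel_nonneg (hS : IsCP S) (r : WStarRep A HA) {ι : Type*}
    (s : Finset ι) (c : ι → C) (p : ι → B × V) (ξ : ι → HA) :
    0 ≤ ∑ i ∈ s, ∑ j ∈ s,
      ⟪ξ i, r.rep (tensorKernel S (star (c i) * c j) (p i) (p j)) (ξ j)⟫_ℂ := by
  refine r.sum_inner_nonneg s (fun i j => tensorKernel S (star (c i) * c j) (p i) (p j))
    (fun i j => hS.star_tensorKernel _ _ _ _) (fun a => ?_) ξ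
  refine (hS.tensorKernel_sum_nonneg s c fun i => ((p i).1, (p i).2 <• a i)).trans_eq ?_
  refine Finset.sum_congr rfl fun i _ => Finset.sum_congr rfl fun j _ => ?_
  rw [tensorKernel_apply, SesqForm.apply_act_right, SesqForm.apply_act_left]
  rfl

variable [NormedAddCommGroup M] [NormedSpace ℂ M] [SMul Aᵐᵒᵖ M] [HilbertModule A M]
  [NormedAddCommGroup X] [InnerProductSpace ℂ X] {r : WStarRep A HA}
  {θ : InteriorTensor r M X} {π : B →⋆ₐ[ℂ] AdjOp A M} {K : V →ₗ[ℂ] M}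

/-- The vectors `π(b)Kv ⊗ ξ` of the interior tensor product. -/
def dilationTensor (θ : InteriorTensor r M X) (π : B →⋆ₐ[ℂ] AdjOp A M) (K : V →ₗ[ℂ] M)
    (p : (B × V) × HA) : X := θ.op (dilationVec π K p.1) p.2

/-- `T` lifts the kernel of `S` to operators on the interior tensor product. -/
def IsKernelLift (S : WTensor r₁ r₂ →ₗ[ℂ] SesqForm A V) (θ : InteriorTensor r M X)
    (π : B →⋆ₐ[ℂ] AdjOp A M) (K : V →ₗ[ℂ] M) (T : C →ₗ[ℂ] (X →L[ℂ] X)) : Prop :=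
  ∀ c p q, ⟪dilationTensor θ π K p, T c (dilationTensor θ π K q)⟫_ℂ =
    ⟪p.2, r.rep (tensorKernel S c p.1 q.1) q.2⟫_ℂ

variable [Group G] {β : G →* (B ≃⋆ₐ[ℂ] B)} {γ : G →* (C ≃⋆ₐ[ℂ] C)}
  {U : G →* (V ≃ₗ[ℂ] V)} {Ut : G →* unitary (AdjOp A M)}

omit [StarOrderedRing A] in
theorem IsCovariantDilation.inner_dilationTensor
    (hdil : IsCovariantDilation (marginalOne S) β U π K Ut) (p q : (B × V) × HA) :
    ⟪dilationTensor θ π K p, dilationTensor θ π K q⟫_ℂ =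
      ⟪p.2, r.rep (tensorKernel S 1 p.1 q.1) q.2⟫_ℂ := by
  rw [dilationTensor, dilationTensor, θ.inner_op, hdil.tensorKernel_one]

variable [CompleteSpace X] [PartialOrder C] [StarOrderedRing C]

theorem exists_clm_of_nonneg (hS : IsCP S)
    (hdil : IsCovariantDilation (marginalOne S) β U π K Ut)
    (hd : Dense (Submodule.span ℂ (Set.range (dilationTensor θ π K)) : Set X)) {c : C}
    (hc : 0 ≤ c) :
    ∃ T : X →L[ℂ] X, ∀ p q, ⟪dilationTensor θ π K p, T (dilationTensor θ π K q)⟫_ℂ =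
      ⟪p.2, r.rep (tensorKernel S c p.1 q.1) q.2⟫_ℂ := by
  refine exists_clm_of_kernel hd (fun p q => ⟪p.2, r.rep (tensorKernel S c p.1 q.1) q.2⟫_ℂ)
    (norm_nonneg c) fun s z => ?_
  -- For fixed s and z this is a positive functional with Q(1) = ‖∑ z_i x_i‖², x_i the dilation
  -- tensors; so 0 ≤ Q(c) ≤ ‖c‖Q(1).
  let Q : C →ₗ[ℂ] ℂ := ∑ i ∈ s, ∑ j ∈ s,
    (star (z i) * z j) • (r.vectorForm i.2 j.2) ∘ₗ
      (LinearMap.proj j.1 : (B × V → A) →ₗ[ℂ] A) ∘ₗ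
      (LinearMap.proj i.1 : (B × V → B × V → A) →ₗ[ℂ] (B × V → A)) ∘ₗ tensorKernel S
  have hQ : ∀ c, Q c = ∑ i ∈ s, ∑ j ∈ s,
      (star (z i) * z j) • ⟪i.2, r.rep (tensorKernel S c i.1 j.1) j.2⟫_ℂ := fun c => by
    simp only [Q, LinearMap.sum_apply, LinearMap.smul_apply]
    rfl
  have hpos : ∀ c : C, 0 ≤ c → 0 ≤ Q c := fun c hc => by
    obtain ⟨d, rfl⟩ := CStarAlgebra.nonneg_iff_eq_star_mul_self.mp hc
    refine (hS.sum_inner_tensorKernel_nonneg r s (fun _ => d) (fun p => p.1)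
      fun p => z p • p.2).trans_eq ?_
    rw [hQ]
    refine Finset.sum_congr rfl fun i _ => Finset.sum_congr rfl fun j _ => ?_
    rw [map_smul, inner_smul_left, inner_smul_right, smul_eq_mul, mul_assoc]
    rfl
  have h1 : ‖∑ i ∈ s, z i • dilationTensor θ π K i‖ ^ 2 = ‖Q 1‖ := by
    have h2 : ⟪∑ i ∈ s, z i • dilationTensor θ π K i, ∑ i ∈ s, z i • dilationTensor θ π K i⟫_ℂ =
        Q 1 := by
      rw [sum_inner, hQ]
      refine Finset.sum_congr rfl fun i _ => ?_
      rw [inner_sum]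
      refine Finset.sum_congr rfl fun j _ => ?_
      rw [inner_smul_left, inner_smul_right, hdil.inner_dilationTensor, smul_eq_mul, mul_assoc]
      rfl
    rw [← h2, inner_self_eq_norm_sq_to_K]
    simp
  rw [h1, ← hQ]
  have h3 : 0 ≤ Q ((‖c‖ : ℂ) • 1 - c) := hpos _ (by
    rw [sub_nonneg]
    have := IsSelfAdjoint.le_algebraMap_norm_self (IsSelfAdjoint.of_nonneg hc)
    rwa [Algebra.algebraMap_eq_smul_one, ← Complex.coe_smul] at this)
  rw [map_sub, map_smul, sub_nonneg] at h3
  refine (CStarAlgebra.norm_le_norm_of_nonneg_of_le (hpos c hc) h3).trans_eq ?_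
  rw [norm_smul, Complex.norm_real, norm_norm]

theorem exists_isKernelLift (hS : IsCP S)
    (hdil : IsCovariantDilation (marginalOne S) β U π K Ut)
    (hd : Dense (Submodule.span ℂ (Set.range (dilationTensor θ π K)) : Set X)) :
    ∃ T : C →ₗ[ℂ] (X →L[ℂ] X), IsKernelLift S θ π K T := by
  let i : (X →L[ℂ] X) →ₗ[ℂ] ((B × V) × HA → (B × V) × HA → ℂ) :=
    { toFun := fun T p q => ⟪dilationTensor θ π K p, T (dilationTensor θ π K q)⟫_ℂ
      map_add' := fun T T' => by
        funext p q; exact inner_add_right _ _ _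
      map_smul' := fun z T => by
        funext p q; exact inner_smul_right _ _ _ }
  let κ : C →ₗ[ℂ] ((B × V) × HA → (B × V) × HA → ℂ) :=
    { toFun := fun c p q => ⟪p.2, r.rep (tensorKernel S c p.1 q.1) q.2⟫_ℂ
      map_add' := fun c c' => by
        funext p q
        rw [map_add]
        exact (r.vectorForm p.2 q.2).map_add _ _
      map_smul' := fun z c => by
        funext p q
        rw [map_smul]
        exact (r.vectorForm p.2 q.2).map_smul _ _ }
  obtain ⟨T, hT⟩ := exists_linear_lift i (fun T T' h => clm_ext_of_dense_span hd fun p q =>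
    congrFun (congrFun h p) q) κ fun c hc => by
      obtain ⟨T, hT⟩ := exists_clm_of_nonneg hS hdil hd hc
      exact ⟨T, funext fun p => funext fun q => hT p q⟩
  exact ⟨T, fun c p q => congrFun (congrFun (hT c) p) q⟩

-- The matrix elements of T(c) are given by elements of A, which commute with u; on a total set this
-- is commutation of T(c) with the ampliation of u.
omit [PartialOrder C] [StarOrderedRing C] in
theorem IsKernelLift.isInvariant {T : C →ₗ[ℂ] (X →L[ℂ] X)} (hT : IsKernelLift S θ π K T)
    (hd : Dense (Submodule.span ℂ (Set.range (dilationTensor θ π K)) : Set X)) (c : C) :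
    θ.IsInvariant (T c) := InteriorTensor.isInvariant_of_commute fun û u hu h1 h2 => by
  have h : T c * û = û * T c := clm_ext_of_dense_span hd fun p q => by
    change ⟪_, T c (û (θ.op _ _))⟫_ℂ = ⟪_, û (T c (dilationTensor θ π K q))⟫_ℂ
    rw [h1, ← inner_star_clm û]
    change _ = ⟪star û (θ.op _ _), _⟫_ℂ
    rw [h2]
    refine (hT c p (q.1, u q.2)).trans (Eq.trans ?_ (hT c (p.1, star u p.2) q).symm)
    change ⟪p.2, r.rep _ (u q.2)⟫_ℂ = ⟪star u p.2, _⟫_ℂ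
    rw [inner_star_clm]
    exact congrArg (fun R : HA →L[ℂ] HA => ⟪p.2, R q.2⟫_ℂ) (hu _).symm
  intro x y
  rw [inner_star_clm]
  exact congrArg (fun R : X →L[ℂ] X => ⟪x, R y⟫_ℂ) h

omit [PartialOrder C] [StarOrderedRing C] [CompleteSpace X] in
theorem IsKernelLift.sum_inner_nonneg {T : C →ₗ[ℂ] (X →L[ℂ] X)} (hT : IsKernelLift S θ π K T)
    (hS : IsCP S) (hd : Dense (Submodule.span ℂ (Set.range (dilationTensor θ π K)) : Set X))
    {n : ℕ} (c : Fin n → C) (y : Fin n → X) :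
    0 ≤ ∑ j, ∑ k, ⟪y j, T (star (c j) * c k) (y k)⟫_ℂ := by
  refine sum_sesq_nonneg_of_dense
    (fun j k => (innerₛₗ ℂ).compl₂ (T (star (c j) * c k)).toLinearMap) (fun j k => ?_)
    (dilationTensor θ π K) hd (fun s z => ?_) y
  · change Continuous fun p : X × X => ⟪p.1, T (star (c j) * c k) p.2⟫_ℂ
    fun_prop
  · refine (hS.sum_inner_tensorKernel_nonneg r s (fun p => c p.1) (fun p => p.2.1)
      fun p => z p • p.2.2).trans_eq ?_
    refine Finset.sum_congr rfl fun p _ => Finset.sum_congr rfl fun q _ => ?_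
    change _ = ⟪z p • dilationTensor θ π K p.2,
      T (star (c p.1) * c q.1) (z q • dilationTensor θ π K q.2)⟫_ℂ
    rw [map_smul, map_smul, inner_smul_left, inner_smul_left, inner_smul_right, inner_smul_right,
      hT]

omit [CompleteSpace X] in
theorem IsKernelLift.map_nonneg {T : C →ₗ[ℂ] (X →L[ℂ] X)} (hT : IsKernelLift S θ π K T)
    (hS : IsCP S) (hd : Dense (Submodule.span ℂ (Set.range (dilationTensor θ π K)) : Set X))
    {c : C} (hc : 0 ≤ c) : 0 ≤ T c := by
  obtain ⟨d, rfl⟩ := CStarAlgebra.nonneg_iff_eq_star_mul_self.mp hc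
  refine clm_nonneg_iff.mpr fun x => ?_
  simpa using hT.sum_inner_nonneg hS hd ![d] ![x]

theorem IsKernelLift.monotone {T : C →ₗ[ℂ] (X →L[ℂ] X)} (hT : IsKernelLift S θ π K T)
    (hS : IsCP S) (hd : Dense (Submodule.span ℂ (Set.range (dilationTensor θ π K)) : Set X)) :
    Monotone T := fun a b h => by
  rw [← sub_nonneg, ← map_sub]
  exact hT.map_nonneg hS hd (sub_nonneg.mpr h)

/-- `E(c)` is the operator on `M` that corresponds to `T(c)` on the interior tensor product. -/
def Intertwines (θ : InteriorTensor r M X) (E : AdjOp A M) (T : X →L[ℂ] X) : Prop :=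
  ∀ m n ξ η, ⟪ξ, r.rep (inner A m (E.1 n)) η⟫_ℂ = ⟪θ.op m ξ, T (θ.op n η)⟫_ℂ

/-- Each T(c) descends by invariance. Separation identifies these descents with the linear E built
from the kernel, so intertwining holds on all of M and not only on dilation vectors. -/
theorem IsKernelLift.exists_hasKernel {T : C →ₗ[ℂ] (X →L[ℂ] X)} (hT : IsKernelLift S θ π K T)
    (hM : IsSelfDual A M) (hD : IsSeparating π K)
    (hd : Dense (Submodule.span ℂ (Set.range (dilationTensor θ π K)) : Set X)) :
    ∃ E : C →ₗ[ℂ] AdjOp A M, HasKernel S π K E ∧ ∀ c, Intertwines θ (E c) (T c) := by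
  have h1 : ∀ c, ∃ E : AdjOp A M, Intertwines θ E (T c) ∧ ∀ p q,
      inner A (dilationVec π K p) (E.1 (dilationVec π K q)) = tensorKernel S c p q := fun c => by
    obtain ⟨E, hE⟩ := (hT.isInvariant hd c).exists_adjOp hM
    refine ⟨E, hE, fun p q => r.ext_inner fun ξ η => ?_⟩
    rw [hE]
    exact hT c (p, ξ) (q, η)
  obtain ⟨E, hE⟩ := hD.exists_hasKernel fun c _ => (h1 c).imp fun E h => h.2
  refine ⟨E, hE, fun c => ?_⟩
  obtain ⟨E', h2, h3⟩ := h1 c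
  rwa [hD.adjOp_ext (E := E c) (E' := E') fun p q => by rw [hE, h3]]

omit [PartialOrder C] [StarOrderedRing C] [CompleteSpace X] in
theorem IsKernelLift.isCPOp {T : C →ₗ[ℂ] (X →L[ℂ] X)} (hT : IsKernelLift S θ π K T)
    (hS : IsCP S) (hd : Dense (Submodule.span ℂ (Set.range (dilationTensor θ π K)) : Set X))
    {E : C →ₗ[ℂ] AdjOp A M} (hE : ∀ c, Intertwines θ (E c) (T c)) : IsCPOp E := by
  intro n c m
  change 0 ≤ ∑ j, ∑ k, inner A (m j) ((E (star (c j) * c k)).1 (m k))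
  refine r.nonneg_iff.mpr fun ξ => ?_
  refine (hT.sum_inner_nonneg hS hd c fun j => θ.op (m j) ξ).trans_eq ?_
  change _ = r.vectorForm ξ ξ _
  simp only [map_sum]
  exact Finset.sum_congr rfl fun j _ => Finset.sum_congr rfl fun k _ => (hE _ _ _ _ _).symm

end Lift

/-! ### Normality -/

section Order

variable {A M : Type*} [NonUnitalCStarAlgebra A] [PartialOrder A] [StarOrderedRing A]
  [NormedAddCommGroup M] [NormedSpace ℂ M] [SMul Aᵐᵒᵖ M] [HilbertModule A M]

theorem AdjOp.le_iff {E F : AdjOp A M} : E ≤ F ↔ ∀ m, inner A m (E.1 m) ≤ inner A m (F.1 m) := by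
  refine forall_congr' fun m => ?_
  change 0 ≤ inner A m (F.1 m - E.1 m) ↔ _
  rw [inner_sub_right_hilbertModule, sub_nonneg]

variable {X : Type*} [NormedAddCommGroup X] [InnerProductSpace ℂ X] [CompleteSpace X]

theorem clm_le_iff {T T' : X →L[ℂ] X} : T ≤ T' ↔ ∀ x, ⟪x, T x⟫_ℂ ≤ ⟪x, T' x⟫_ℂ := by
  rw [← sub_nonneg, clm_nonneg_iff]
  refine forall_congr' fun x => ?_
  rw [sub_apply, inner_sub_right, sub_nonneg]

variable {HA : Type*} [NormedAddCommGroup HA] [InnerProductSpace ℂ HA] [CompleteSpace HA]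

theorem WStarRep.le_iff (r : WStarRep A HA) {a b : A} :
    a ≤ b ↔ ∀ ξ, ⟪ξ, r.rep a ξ⟫_ℂ ≤ ⟪ξ, r.rep b ξ⟫_ℂ := by
  rw [← sub_nonneg, r.nonneg_iff]
  refine forall_congr' fun x => ?_
  rw [map_sub, sub_apply, inner_sub_right, sub_nonneg]

/-- A bounded increasing net of operators converges weakly to an operator. -/
theorem exists_weak_limit_of_monotone {D : Type*} [PartialOrder D]
    {T : D → X →L[ℂ] X} (hT : Monotone T) {s : Set D} (hs : s.Nonempty)
    (hd : DirectedOn (· ≤ ·) s) {c : D} (hc : c ∈ upperBounds s) :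
    ∃ (𝓤 : Ultrafilter D) (T₀ : X →L[ℂ] X), (∀ᶠ a in 𝓤, a ∈ s) ∧
      (∀ x y, Tendsto (fun a => ⟪x, T a y⟫_ℂ) 𝓤 (𝓝 ⟪x, T₀ y⟫_ℂ)) ∧
      T₀ ≤ T c ∧ ∀ a ∈ s, T a ≤ T₀ := by
  obtain ⟨𝓤, h1, h2⟩ := exists_ultrafilter_directedOn hs hd
  obtain ⟨a₀, ha₀⟩ := hs
  obtain ⟨T₀, hT₀⟩ := exists_weak_limit 𝓤 T (C := ‖T c‖ + ‖T c - T a₀‖) (by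
    filter_upwards [h1, h2 a₀ ha₀] with a h3 h4
    exact norm_le_of_le_of_le (hT h4) (hT (hc h3)))
  refine ⟨𝓤, T₀, h1, hT₀, clm_le_iff.mpr fun x => ?_, fun a ha => clm_le_iff.mpr fun x => ?_⟩
  · refine le_of_tendsto (hT₀ x x) ?_
    filter_upwards [h1] with a ha
    exact clm_le_iff.mp (hT (hc ha)) x
  · refine ge_of_tendsto (hT₀ x x) ?_
    filter_upwards [h2 a ha] with b hb
    exact clm_le_iff.mp (hT hb) x

end Order

/-! ### Normality of the second marginal versus normality of E. -/

section Normal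

variable {A V B C H₁ H₂ M HA X : Type*} [NonUnitalCStarAlgebra A] [PartialOrder A]
  [StarOrderedRing A] [AddCommGroup V] [Module ℂ V] [SMul Aᵐᵒᵖ V] [CStarAlgebra B] [CStarAlgebra C]
  [NormedAddCommGroup H₁] [InnerProductSpace ℂ H₁] [CompleteSpace H₁]
  [NormedAddCommGroup H₂] [InnerProductSpace ℂ H₂] [CompleteSpace H₂]
  {r₁ : WStarRep B H₁} {r₂ : WStarRep C H₂}
  [NormedAddCommGroup HA] [InnerProductSpace ℂ HA] [CompleteSpace HA]
  {S : WTensor r₁ r₂ →ₗ[ℂ] SesqForm A V}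
  [NormedAddCommGroup M] [NormedSpace ℂ M] [SMul Aᵐᵒᵖ M] [HilbertModule A M]
  [NormedAddCommGroup X] [InnerProductSpace ℂ X] [CompleteSpace X] {r : WStarRep A HA}
  {θ : InteriorTensor r M X} {π : B →⋆ₐ[ℂ] AdjOp A M} {K : V →ₗ[ℂ] M}
  [PartialOrder C] [StarOrderedRing C]

omit [PartialOrder A] [StarOrderedRing A] [PartialOrder C] [StarOrderedRing C] in
theorem marginalTwo_apply (c : C) (v w : V) :
    (marginalTwo S c).1 v w = tensorKernel S c (1, v) (1, w) := by
  rw [tensorKernel_apply, star_one, one_mul]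
  rfl

theorem IsCP.marginalTwo_monotone (hS : IsCP S) (v : V) :
    Monotone fun c : C => (marginalTwo S c).1 v v := fun a b h => by
  have h1 := hS.tensorKernel_nonneg {()} (sub_nonneg.mpr h) fun _ => (1, v)
  rw [Finset.sum_singleton, Finset.sum_singleton, map_sub, Pi.sub_apply, Pi.sub_apply,
    sub_nonneg] at h1
  simpa only [marginalTwo_apply] using h1

omit [PartialOrder C] [StarOrderedRing C] in
theorem IsCP.isSelfAdjoint_marginalTwo (hS : IsCP S) (v : V) {c : C} (hc : IsSelfAdjoint c) :
    IsSelfAdjoint ((marginalTwo S c).1 v v) := by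
  have h := hS.star_tensorKernel 1 c (1, v) (1, v)
  rw [star_one, one_mul, mul_one, hc.star_eq] at h
  rw [marginalTwo_apply]
  exact h

omit [CompleteSpace X] [PartialOrder C] [StarOrderedRing C] [StarOrderedRing A] in
theorem IsKernelLift.inner_marginalTwo {T : C →ₗ[ℂ] (X →L[ℂ] X)} (hT : IsKernelLift S θ π K T)
    (c : C) (v w : V) (ξ η : HA) :
    ⟪θ.op (K v) ξ, T c (θ.op (K w) η)⟫_ℂ = ⟪ξ, r.rep ((marginalTwo S c).1 v w) η⟫_ℂ := by
  rw [marginalTwo_apply, ← dilationVec_one π K v, ← dilationVec_one π K w]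
  exact hT c ((1, v), ξ) ((1, w), η)

-- Expresses that T(c) commutes with π(b) ⊗ 1 without constructing that operator on X.
omit [CompleteSpace X] [PartialOrder C] [StarOrderedRing C] [StarOrderedRing A] in
theorem IsKernelLift.inner_shift {T : C →ₗ[ℂ] (X →L[ℂ] X)} (hT : IsKernelLift S θ π K T)
    (c : C) (p q : (B × V) × HA) :
    ⟪dilationTensor θ π K p, T c (dilationTensor θ π K q)⟫_ℂ =
      ⟪dilationTensor θ π K ((star q.1.1 * p.1.1, p.1.2), p.2), T c (θ.op (K q.1.2) q.2)⟫_ℂ := by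
  rw [hT, ← dilationVec_one π K q.1.2]
  refine Eq.trans ?_ (hT c ((star q.1.1 * p.1.1, p.1.2), p.2) ((1, q.1.2), q.2)).symm
  rw [tensorKernel_apply, tensorKernel_apply, star_mul, star_star, mul_one]

/-- A weak limit along an increasing net is the value at the supremum if the second marginal is
normal. -/
theorem IsKernelLift.weak_limit_eq {T : C →ₗ[ℂ] (X →L[ℂ] X)} (hT : IsKernelLift S θ π K T)
    (hS : IsCP S) (hd : Dense (Submodule.span ℂ (Set.range (dilationTensor θ π K)) : Set X))
    (hN : IsNormalCP (marginalTwo S)) {s : Set C} (hs : s.Nonempty) (hdir : DirectedOn (· ≤ ·) s)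
    (hsa : ∀ a ∈ s, IsSelfAdjoint a) {c : C} (hc : IsLUB s c) {l : Filter C} [l.NeBot]
    {T₀ : X →L[ℂ] X} (hl : ∀ x y, Tendsto (fun a => ⟪x, T a y⟫_ℂ) l (𝓝 ⟪x, T₀ y⟫_ℂ))
    (h₀ : T₀ ≤ T c) (h₁ : ∀ a ∈ s, T a ≤ T₀) : T₀ = T c := by
  -- Normality of c ↦ S²_c(v,v) followed by normality of the vector functional at ξ makes the
  -- quadratic forms of T₀ ≤ T(c) agree at Kv ⊗ ξ; a positive difference then annihilates that
  -- vector.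
  have h2 : ∀ v ξ, (T c - T₀) (θ.op (K v) ξ) = 0 := fun v ξ => by
    have hlub := (r.isNormalPositive ξ).2 _ (hs.image _)
      (hdir.mono_comp fun _ _ h => hS.marginalTwo_monotone v h)
      (by rintro _ ⟨a, ha, rfl⟩; exact hS.isSelfAdjoint_marginalTwo v (hsa a ha)) _
      (hN v s hs hdir hsa c hc)
    have h3 : ⟪θ.op (K v) ξ, T c (θ.op (K v) ξ)⟫_ℂ ≤ ⟪θ.op (K v) ξ, T₀ (θ.op (K v) ξ)⟫_ℂ := by
      rw [hT.inner_marginalTwo]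
      refine hlub.2 ?_
      rintro _ ⟨_, ⟨a, ha, rfl⟩, rfl⟩
      refine (hT.inner_marginalTwo a v v ξ ξ).symm.trans_le ?_
      exact clm_le_iff.mp (h₁ a ha) _
    refine clm_apply_eq_zero_of_nonneg (sub_nonneg.mpr h₀) ?_
    rw [sub_apply, inner_sub_right, sub_eq_zero]
    exact le_antisymm h3 (clm_le_iff.mp h₀ _)
  -- `inner_shift` reduces the right-hand vector to Kv ⊗ ξ, for T(c) directly and for T₀ through the
  -- limit.
  refine clm_ext_of_dense_span hd fun p q => ?_
  have h3 := sub_eq_zero.mp (h2 q.1.2 q.2)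
  change T c _ = T₀ _ at h3
  rw [hT.inner_shift, h3]
  exact tendsto_nhds_unique (hl _ _) ((hl _ _).congr fun a => (hT.inner_shift a p q).symm)

/-- As the weak limit is T(c) itself, a bound R for all E(a) passes to E(c) through the quadratic
forms at m ⊗ ξ. -/
theorem IsKernelLift.isNormalMap_of_marginalTwo {T : C →ₗ[ℂ] (X →L[ℂ] X)}
    (hT : IsKernelLift S θ π K T) (hS : IsCP S)
    (hd : Dense (Submodule.span ℂ (Set.range (dilationTensor θ π K)) : Set X))
    {E : C →ₗ[ℂ] AdjOp A M} (hE : ∀ c, Intertwines θ (E c) (T c))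
    (hN : IsNormalCP (marginalTwo S)) : IsNormalMap E := by
  intro s hs hdir hsa c hc
  obtain ⟨𝓤, T₀, h1, h2, h3, h4⟩ :=
    exists_weak_limit_of_monotone (hT.monotone hS hd) hs hdir hc.1
  obtain rfl := hT.weak_limit_eq hS hd hN hs hdir hsa hc h2 h3 h4
  refine ⟨?_, fun R hR => ?_⟩
  · rintro _ ⟨a, ha, rfl⟩
    refine AdjOp.le_iff.mpr fun m => r.le_iff.mpr fun ξ => ?_
    rw [hE, hE]
    exact clm_le_iff.mp (h4 a ha) _
  · refine AdjOp.le_iff.mpr fun m => r.le_iff.mpr fun ξ => ?_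
    rw [hE]
    refine le_of_tendsto (h2 _ _) ?_
    filter_upwards [h1] with a ha
    rw [← hE]
    exact r.le_iff.mp (AdjOp.le_iff.mp (hR ⟨a, ha, rfl⟩) m) ξ

/-- The supremum of the E(a) is taken among adjointable operators, so the weak limit must be
descended to M before it can compete. Invariance survives weak limits, which makes this possible. -/
theorem IsKernelLift.isNormalCP_marginalTwo {T : C →ₗ[ℂ] (X →L[ℂ] X)}
    (hT : IsKernelLift S θ π K T) (hS : IsCP S) (hM : IsSelfDual A M)
    (hd : Dense (Submodule.span ℂ (Set.range (dilationTensor θ π K)) : Set X))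
    {E : C →ₗ[ℂ] AdjOp A M} (hE : ∀ c, Intertwines θ (E c) (T c))
    (hN : IsNormalMap E) : IsNormalCP (marginalTwo S) := by
  intro v s hs hdir hsa c hc
  obtain ⟨𝓤, T₀, h1, h2, h3, h4⟩ :=
    exists_weak_limit_of_monotone (hT.monotone hS hd) hs hdir hc.1
  have hinv : θ.IsInvariant T₀ := fun u hu m n ξ η =>
    tendsto_nhds_unique (h2 _ _) ((h2 _ _).congr fun a => (hT.isInvariant hd a u hu m n ξ η).symm)
  obtain ⟨E₀, hE₀⟩ := hinv.exists_adjOp hM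
  refine ⟨?_, fun y hy => r.le_iff.mpr fun ξ => ?_⟩
  · rintro _ ⟨a, ha, rfl⟩
    exact hS.marginalTwo_monotone v (hc.1 ha)
  · have h5 : E c ≤ E₀ := (hN s hs hdir hsa c hc).2 (by
      rintro _ ⟨a, ha, rfl⟩
      refine AdjOp.le_iff.mpr fun m => r.le_iff.mpr fun ξ => ?_
      rw [hE, hE₀]
      exact clm_le_iff.mp (h4 a ha) _)
    have h6 := r.le_iff.mp (AdjOp.le_iff.mp h5 (K v)) ξ
    rw [hE, hE₀, hT.inner_marginalTwo] at h6
    refine h6.trans (le_of_tendsto (h2 _ _) ?_)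
    filter_upwards [h1] with a ha
    rw [hT.inner_marginalTwo]
    exact r.le_iff.mp (hy ⟨a, ha, rfl⟩) ξ

end Normal

end CovKSGNS

end

/-! ### Assembly of (a) and (b). -/

open CovKSGNS

theorem mainTheorem11
    {A V B C G H₁ H₂ : Type*}
    [NonUnitalCStarAlgebra A] [PartialOrder A] [StarOrderedRing A]
    [AddCommGroup V] [Module ℂ V] [SMul Aᵐᵒᵖ V] [RightModule A V]
    [CStarAlgebra B]
    [CStarAlgebra C] [PartialOrder C] [StarOrderedRing C]
    [NormedAddCommGroup H₁] [InnerProductSpace ℂ H₁] [CompleteSpace H₁]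
    [NormedAddCommGroup H₂] [InnerProductSpace ℂ H₂] [CompleteSpace H₂]
    (r₁ : WStarRep B H₁) (r₂ : WStarRep C H₂)
    [Group G] (β : G →* (B ≃⋆ₐ[ℂ] B)) (γ : G →* (C ≃⋆ₐ[ℂ] C))
    (δ : G →* (WTensor r₁ r₂ ≃⋆ₐ[ℂ] WTensor r₁ r₂)) (hδ : IsTensorAction β γ δ)
    (U : G →* (V ≃ₗ[ℂ] V)) (hU : ∀ g : G, IsALinear A (U g))
    (S : WTensor r₁ r₂ →ₗ[ℂ] SesqForm A V) (hS : IsCP S) (hSU : IsCovariant δ U S) :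
    (∀ {M : Type*} [NormedAddCommGroup M] [NormedSpace ℂ M] [SMul Aᵐᵒᵖ M] [HilbertModule A M]
        (π : B →⋆ₐ[ℂ] AdjOp A M) (K : V →ₗ[ℂ] M) (Ut : G →* unitary (AdjOp A M)),
        IsMinimalDilation (marginalOne S) β U π K Ut → IsSelfDual A M →
        ∃ E : C →ₗ[ℂ] AdjOp A M, IsSubminimal S γ π K Ut E ∧ E 1 = 1 ∧
          ∀ E' : C →ₗ[ℂ] AdjOp A M, IsSubminimal S γ π K Ut E' → E' = E) ∧
    (∀ {HA : Type*} [NormedAddCommGroup HA] [InnerProductSpace ℂ HA] [CompleteSpace HA]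
        (_ : WStarRep A HA)
        {L : Type*} [NormedAddCommGroup L] [NormedSpace ℂ L] [SMul Aᵐᵒᵖ L] [HilbertModule A L]
        (π : B →⋆ₐ[ℂ] AdjOp A L) (K : V →ₗ[ℂ] L) (Ut : G →* unitary (AdjOp A L)),
        IsWStarMinimalDilation (marginalOne S) β U π K Ut →
        ∃ E : C →ₗ[ℂ] AdjOp A L, IsSubminimal S γ π K Ut E ∧ E 1 = 1 ∧
          (∀ E' : C →ₗ[ℂ] AdjOp A L, IsSubminimal S γ π K Ut E' → E' = E) ∧
          (IsNormalCP (marginalTwo S) ↔ IsNormalMap E)) := by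
  refine ⟨?_, ?_⟩
  · intro M _ _ _ _ π K Ut hdil hM
    have hd := hdil.dense
    rw [dilationSpan_eq] at hd
    have hD := isSeparating_of_dense hd
    have hdil' := hdil.toIsCovariantDilation
    obtain ⟨E, hE⟩ := hD.exists_hasKernel (S := S) fun c hc =>
      exists_adjOp_of_dense hM hd hdil' hS hc
    exact ⟨E, hE.isSubminimal hD hdil' hδ hSU (hE.isCPOp_of_dense hd hS), hD.map_one hdil' hE,
      fun E' hE' => hD.subminimal_unique hE hE'⟩
  · intro HA _ _ _ r L _ _ _ _ π K Ut hdil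
    have hD := isSeparating_of_tau_dense r hdil.dense
    have hM := hdil.selfDual
    have hdil' := hdil.toIsCovariantDilation
    obtain ⟨X, _, _, _, ⟨θ⟩⟩ := exists_interiorTensor r (M := L)
    -- Totality of the vectors π(b)Kv ⊗ ξ in X replaces the norm density of the span in L used for
    -- (a).
    have hd : Dense (Submodule.span ℂ (Set.range (dilationTensor θ π K)) : Set X) :=
      θ.dense_span_of_separating hM (dilationVec π K) hD
    obtain ⟨T, hT⟩ := exists_isKernelLift (θ := θ) hS hdil' hd
    obtain ⟨E, hE, hET⟩ := hT.exists_hasKernel hM hD hd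
    exact ⟨E, hE.isSubminimal hD hdil' hδ hSU (hT.isCPOp hS hd hET), hD.map_one hdil' hE,
      fun E' hE' => hD.subminimal_unique hE hE', hT.isNormalMap_of_marginalTwo hS hd hET,
      hT.isNormalCP_marginalTwo hS hM hd hET⟩
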